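/- Let $F$ be a number field with ring of adeles $\mathbb{A}$, let $n\ge 1$ and $G=GL(n)$ over $F$. Let $K\subset G(\mathbb{A})$ be the standard maximal compact subgroup, i.e. the product of the groups $GL(n,\mathcal{O}_v)$ ($v$ finite), $O(n)$ ($v$ real) and $U(n)$ ($v$ complex). A parabolic subgroup $P$ of $G$ is called standard if it contains the group of upper triangular matrices; let $a_P=\mathrm{Hom}_{\mathbb{Z}}(X^*(P),\mathbb{R})$, where $X^*(P)$ is the group of rational characters of $P$, let $H_P:G(\mathbb{A})\to a_P$ be the Harish-Chandra map, defined by $\langle\chi,H_P(pk)\rangle=\log|\chi(p)|_{\mathbb{A}}$ for $p\in P(\mathbb{A})$, $k\in K$, $\chi\in X^*(P)$, and let $\rho_P$ be half the sum of the roots of the diagonal torus in the unipotent radical of $P$. For $g\in G(\mathbb{A})$ the instability degree of $g$ is $$\deg_i(g)=\max_{(P,\delta)}\langle\rho_P,H_P(\delta g)\rangle,$$ where $(P,\delta)$ runs over the pairs formed by a standard parabolic subgroup $P$ of $G$ and an element $\delta\in P(F)\backslash G(F)$. Such a pair $(P,\delta)$ is called canonical for $g$ if 1. $\langle\rho_P,H_P(\delta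 g)\rangle=\deg_i(g)$, and 2. every parabolic subgroup $Q\supseteq P$ of $G$ with $\langle\rho_Q,H_Q(\delta g)\rangle=\deg_i(g)$ is equal to $P$. Then, for every $g\in G(\mathbb{A})$, the maximum defining $\deg_i(g)$ exists (the supremum is finite and attained), and there is exactly one canonical pair for $g$. -/

import Mathlib

open scoped NumberField

noncomputable section

namespace AdelicGL

open NumberField IsDedekindDomain

/-! ## Standard parabolic subgroups of `GL(n)` -/

section Parabolic

variable {n : ℕ}

/-- The `R`-points `P(R)` of the standard parabolic subgroup `P` of `GL(n)` of type `c`: the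
invertible block upper triangular matrices, with diagonal blocks of sizes the parts of the
composition `c` of `n`. These are the parabolic subgroups that contain the Borel subgroup of upper
triangular matrices, each of them for exactly one `c`. -/
def parabolic (c : Composition n) (R : Type*) [CommRing R] :
    Subgroup (Matrix.GeneralLinearGroup (Fin n) R) where
  carrier := {g | (g : Matrix (Fin n) (Fin n) R).BlockTriangular c.index}
  mul_mem' := fun ha hb => Matrix.BlockTriangular.mul ha hb
  one_mem' := Matrix.blockTriangular_one
  inv_mem' := by
    intro g hg
    have : Invertible (g : Matrix (Fin n) (Fin n) R) := g.invertible
    have hg' : (g : Matrix (Fin n) (Fin n) R).BlockTriangular c.index := hg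
    have h := Matrix.blockTriangular_inv_of_blockTriangular hg'
    change Matrix.BlockTriangular ((g⁻¹ : Matrix.GeneralLinearGroup (Fin n) R) :
      Matrix (Fin n) (Fin n) R) c.index
    rwa [Matrix.coe_units_inv]

theorem blockDet_mul (c : Composition n) {R : Type*} [CommRing R] (b : Fin c.length)
    {A B : Matrix (Fin n) (Fin n) R} (hA : A.BlockTriangular c.index)
    (hB : B.BlockTriangular c.index) :
    ((A * B).toSquareBlock c.index b).det
      = (A.toSquareBlock c.index b).det * (B.toSquareBlock c.index b).det := by
  rw [← Matrix.det_mul]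
  congr 1
  ext i j
  simp only [Matrix.toSquareBlock_def, Matrix.mul_apply, Matrix.of_apply]
  rw [← Finset.sum_subtype (p := fun l => c.index l = b)
    (Finset.univ.filter fun l => c.index l = b) (by simp) (fun l => A i l * B l j)]
  symm
  apply Finset.sum_filter_of_ne
  intro l _ hl
  have hi := i.2
  have hj := j.2
  apply le_antisymm
  · by_contra hlt
    exact hl (by rw [hB (show c.index j < c.index l by rw [hj]; exact not_le.1 hlt), mul_zero])
  · by_contra hlt
    exact hl (by rw [hA (show c.index l < c.index i by rw [hi]; exact not_le.1 hlt), zero_mul])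

/-- The character `det_b` of `P`: the determinant of the `b`-th diagonal block. The `det_b` form
the standard basis of the group `X^*(P)` of rational characters of `P`. -/
def blockDet (c : Composition n) (R : Type*) [CommRing R] (b : Fin c.length) :
    parabolic c R →* Rˣ :=
  MonoidHom.toHomUnits
    { toFun := fun p =>
        (((p : Matrix.GeneralLinearGroup (Fin n) R) : Matrix (Fin n) (Fin n) R).toSquareBlock
          c.index b).det
      map_one' := by
        have : ((1 : Matrix (Fin n) (Fin n) R).toSquareBlock c.index b) = 1 := by
          ext i j
          simp [Matrix.toSquareBlock_def, Matrix.one_apply, Subtype.ext_iff]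
        exact (congrArg Matrix.det this).trans Matrix.det_one
      map_mul' := fun p q => blockDet_mul c b p.2 q.2 }

theorem coe_blockDet (c : Composition n) {R : Type*} [CommRing R] (b : Fin c.length)
    (p : parabolic c R) : ((blockDet c R b p : Rˣ) : R) =
      (((p : Matrix.GeneralLinearGroup (Fin n) R) : Matrix (Fin n) (Fin n) R).toSquareBlock
          c.index b).det := rfl

/-- Half the sum of the roots `e_i - e_j` of the diagonal torus in the unipotent radical of `P`, as
an element of `a_0^* = ℝⁿ`. -/
def rho (c : Composition n) : Fin n → ℝ :=
  (1 / 2 : ℝ) • ∑ i : Fin n, ∑ j : Fin n,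
    if c.index i < c.index j then (Pi.single i 1 - Pi.single j 1 : Fin n → ℝ) else 0

/-- The natural inclusion `a_P ⊂ a_0 = ℝⁿ`. An element `H` of `a_P = Hom(X^*(P), ℝ)` is given by
its values `H b` on the basis `det_b` of `X^*(P)`; it goes to the vector that is constant, with
sum `H b`, on each block `b`. -/
def inclA0 (c : Composition n) (H : Fin c.length → ℝ) : Fin n → ℝ :=
  fun i => H (c.index i) / (c.blocksFun (c.index i) : ℝ)

theorem map_mem_parabolic (c : Composition n) {R S : Type*} [CommRing R] [CommRing S] (f : R →+* S)
    {p : Matrix.GeneralLinearGroup (Fin n) R} (hp : p ∈ parabolic c R) :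
    Matrix.GeneralLinearGroup.map f p ∈ parabolic c S := by
  intro i j hij
  have := hp hij
  simp [this]

theorem map_blockDet (c : Composition n) {R S : Type*} [CommRing R] [CommRing S] (f : R →+* S)
    (b : Fin c.length) {p : Matrix.GeneralLinearGroup (Fin n) R} (hp : p ∈ parabolic c R) :
    ((blockDet c S b ⟨_, map_mem_parabolic c f hp⟩ : Sˣ) : S)
      = f (blockDet c R b ⟨p, hp⟩ : Rˣ) := by
  rw [coe_blockDet, coe_blockDet, RingHom.map_det]
  rfl

end Parabolic

/-! ## Adeles, ideles and the maximal compact subgroup -/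

section Adeles

variable (F : Type*) [Field F] [NumberField F]

/-- The projection of the adele ring to the completion at a finite place. -/
def finiteComponent (v : HeightOneSpectrum (𝓞 F)) :
    AdeleRing (𝓞 F) F →+* v.adicCompletion F where
  toFun x := x.2 v
  map_one' := rfl
  map_mul' _ _ := rfl
  map_zero' := rfl
  map_add' _ _ := rfl

/-- The projection of the adele ring to the completion at an infinite place, followed by the
embedding of this completion in `ℂ` (its image is `ℝ` at a real place, `ℂ` at a complex place). -/
def infiniteComponent (v : InfinitePlace F) : AdeleRing (𝓞 F) F →+* ℂ :=
  (InfinitePlace.Completion.extensionEmbedding v).comp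
    { toFun := fun x => x.1 v
      map_one' := rfl
      map_mul' := fun _ _ => rfl
      map_zero' := rfl
      map_add' := fun _ _ => rfl }

variable {F}

/-- The adelic absolute value of an idele: the product over all places of the normalized local
absolute values. -/
def ideleNorm (x : (AdeleRing (𝓞 F) F)ˣ) : ℝ :=
  (∏ v : InfinitePlace F, ‖(x : AdeleRing (𝓞 F) F).1 v‖ ^ v.mult) *
    ∏ᶠ v : HeightOneSpectrum (𝓞 F), ‖(x : AdeleRing (𝓞 F) F).2 v‖

theorem norm_infiniteComponent (v : InfinitePlace F) (x : AdeleRing (𝓞 F) F) :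
    ‖infiniteComponent F v x‖ = ‖x.1 v‖ :=
  (InfinitePlace.Completion.isometry_extensionEmbedding v).norm_map_of_map_zero (map_zero _) _

theorem norm_finite_eq_one {v : HeightOneSpectrum (𝓞 F)} {x : v.adicCompletion F}
    (h : Valued.v x = 1) : ‖x‖ = 1 := by
  rw [FinitePlace.norm_def, h]
  simp

theorem finite_mulSupport_idele (x : (AdeleRing (𝓞 F) F)ˣ) :
    (Function.mulSupport fun v : HeightOneSpectrum (𝓞 F) =>
      ‖(x : AdeleRing (𝓞 F) F).2 v‖).Finite := by
  have hx : IsUnit (x : AdeleRing (𝓞 F) F).2 :=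
    ⟨⟨(x : AdeleRing (𝓞 F) F).2, ((x⁻¹ : (AdeleRing (𝓞 F) F)ˣ) : AdeleRing (𝓞 F) F).2,
      congrArg Prod.snd x.mul_inv, congrArg Prod.snd x.inv_mul⟩, rfl⟩
  have h := (FiniteAdeleRing.isUnit_iff.1 hx).2
  rw [Filter.eventually_cofinite] at h
  refine h.subset ?_
  intro v hv hv'
  exact hv (norm_finite_eq_one hv')

theorem ideleNorm_mul (x y : (AdeleRing (𝓞 F) F)ˣ) :
    ideleNorm (x * y) = ideleNorm x * ideleNorm y := by
  have h1 : ∀ v : InfinitePlace F, ‖((x * y : (AdeleRing (𝓞 F) F)ˣ) : AdeleRing (𝓞 F) F).1 v‖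
      = ‖(x : AdeleRing (𝓞 F) F).1 v‖ * ‖(y : AdeleRing (𝓞 F) F).1 v‖ := fun v => norm_mul _ _
  have h2 : ∀ v : HeightOneSpectrum (𝓞 F),
      ‖((x * y : (AdeleRing (𝓞 F) F)ˣ) : AdeleRing (𝓞 F) F).2 v‖
      = ‖(x : AdeleRing (𝓞 F) F).2 v‖ * ‖(y : AdeleRing (𝓞 F) F).2 v‖ := fun v => norm_mul _ _
  unfold ideleNorm
  simp only [h1, h2, mul_pow, Finset.prod_mul_distrib]
  rw [finprod_mul_distrib (finite_mulSupport_idele x) (finite_mulSupport_idele y)]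
  ring

/-- The product formula. -/
theorem ideleNorm_principal (x : Fˣ) :
    ideleNorm (Units.map (algebraMap F (AdeleRing (𝓞 F) F)).toMonoidHom x) = 1 := by
  have h := prod_abs_eq_one (K := F) x.ne_zero
  rw [← finprod_comp_equiv FinitePlace.equivHeightOneSpectrum.symm] at h
  rw [← h]
  unfold ideleNorm
  congr 1
  refine Finset.prod_congr rfl fun v _ => ?_
  congr 1
  exact (InfinitePlace.Completion.norm_coe _ _)

variable (F)

/-- The standard maximal compact subgroup `K` of `GL(n, 𝔸)`: the product of the `GL(n, O_v)` over
the finite places `v`, of the `O(n)` over the real places and of the `U(n)` over the complex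
places. -/
def maxCompact (n : ℕ) : Subgroup (Matrix.GeneralLinearGroup (Fin n) (AdeleRing (𝓞 F) F)) where
  carrier := {k |
    (∀ v : HeightOneSpectrum (𝓞 F), Matrix.GeneralLinearGroup.map (finiteComponent F v) k ∈
      (Matrix.GeneralLinearGroup.map (n := Fin n) (v.adicCompletionIntegers F).subtype).range) ∧
    ∀ v : InfinitePlace F,
      (Matrix.GeneralLinearGroup.map (infiniteComponent F v) k : Matrix (Fin n) (Fin n) ℂ) ∈
        Matrix.unitaryGroup (Fin n) ℂ}
  mul_mem' := by
    rintro a b ⟨ha, ha'⟩ ⟨hb, hb'⟩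
    refine ⟨fun v => ?_, fun v => ?_⟩
    · rw [map_mul]
      exact mul_mem (ha v) (hb v)
    · rw [map_mul]
      exact mul_mem (ha' v) (hb' v)
  one_mem' := by
    refine ⟨fun v => ?_, fun v => ?_⟩
    · rw [map_one]
      exact one_mem _
    · rw [map_one]
      exact one_mem _
  inv_mem' := by
    rintro a ⟨ha, ha'⟩
    refine ⟨fun v => ?_, fun v => ?_⟩
    · rw [map_inv]
      exact inv_mem (ha v)
    · rw [map_inv, Units.inv_eq_of_mul_eq_one_right
        (a := star (Matrix.GeneralLinearGroup.map (infiniteComponent F v) a :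
          Matrix (Fin n) (Fin n) ℂ)) ((Matrix.mem_unitaryGroup_iff).1 (ha' v))]
      exact Unitary.star_mem (ha' v)

variable {F} {n : ℕ}

/-- The characters `det_b` of `P(𝔸)` have adelic absolute value `1` on `P(𝔸) ∩ K`. -/
theorem ideleNorm_blockDet_of_mem_maxCompact (c : Composition n) (b : Fin c.length)
    {k : Matrix.GeneralLinearGroup (Fin n) (AdeleRing (𝓞 F) F)}
    (hp : k ∈ parabolic c (AdeleRing (𝓞 F) F)) (hk : k ∈ maxCompact F n) :
    ideleNorm (blockDet c _ b ⟨k, hp⟩) = 1 := by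
  have key : ∀ v : HeightOneSpectrum (𝓞 F), ∀ (l : Matrix.GeneralLinearGroup (Fin n)
      (AdeleRing (𝓞 F) F)) (hl : l ∈ parabolic c (AdeleRing (𝓞 F) F)), l ∈ maxCompact F n →
      Valued.v (finiteComponent F v (blockDet c _ b ⟨l, hl⟩ : (AdeleRing (𝓞 F) F)ˣ)) ≤ 1 := by
    intro v l hl hlK
    obtain ⟨m, hm⟩ := hlK.1 v
    rw [← map_blockDet c (finiteComponent F v) b hl, coe_blockDet]
    simp only [← hm]
    have : ((Matrix.GeneralLinearGroup.map (v.adicCompletionIntegers F).subtype m :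
        Matrix (Fin n) (Fin n) (v.adicCompletion F)).toSquareBlock c.index b).det
        = (v.adicCompletionIntegers F).subtype
          (((m : Matrix (Fin n) (Fin n) (v.adicCompletionIntegers F)).toSquareBlock
            c.index b).det) := by
      rw [RingHom.map_det]
      rfl
    rw [this]
    exact (HeightOneSpectrum.mem_adicCompletionIntegers (𝓞 F) F v).1 (SetLike.coe_mem _)
  have hmul : blockDet c _ b ⟨k, hp⟩ * blockDet c _ b ⟨k⁻¹, inv_mem hp⟩ = 1 := by
    rw [← map_mul]
    have : (⟨k, hp⟩ * ⟨k⁻¹, inv_mem hp⟩ : parabolic c (AdeleRing (𝓞 F) F)) = 1 :=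
      Subtype.ext (mul_inv_cancel k)
    rw [this, map_one]
  unfold ideleNorm
  rw [Finset.prod_eq_one, finprod_eq_one_of_forall_eq_one, one_mul]
  · intro v
    apply norm_finite_eq_one
    have h1 := key v k hp hk
    have h2 := key v k⁻¹ (inv_mem hp) (inv_mem hk)
    have h3 : Valued.v (finiteComponent F v (blockDet c _ b ⟨k, hp⟩ : (AdeleRing (𝓞 F) F)ˣ)) *
        Valued.v (finiteComponent F v (blockDet c _ b ⟨k⁻¹, inv_mem hp⟩ : (AdeleRing (𝓞 F) F)ˣ))
        = 1 := by
      rw [← map_mul, ← map_mul, ← Units.val_mul, hmul, Units.val_one, map_one, map_one]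
    refine le_antisymm h1 ?_
    rw [← h3]
    exact mul_le_of_le_one_right' h2
  · intro v _
    rw [← norm_infiniteComponent]
    have hU := hk.2 v
    have h1 : star (Matrix.GeneralLinearGroup.map (infiniteComponent F v) k :
          Matrix (Fin n) (Fin n) ℂ) =
        (Matrix.GeneralLinearGroup.map (infiniteComponent F v) k⁻¹ :
          Matrix (Fin n) (Fin n) ℂ) := by
      rw [map_inv]
      exact (Units.inv_eq_of_mul_eq_one_right ((Matrix.mem_unitaryGroup_iff).1 hU)).symm
    have h2 : infiniteComponent F v (blockDet c _ b ⟨k⁻¹, inv_mem hp⟩ : (AdeleRing (𝓞 F) F)ˣ)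
        = star (infiniteComponent F v (blockDet c _ b ⟨k, hp⟩ : (AdeleRing (𝓞 F) F)ˣ)) := by
      rw [← map_blockDet c (infiniteComponent F v) b hp,
        ← map_blockDet c (infiniteComponent F v) b (inv_mem hp), coe_blockDet, coe_blockDet,
        ← Matrix.det_conjTranspose]
      simp only [← h1]
      rfl
    have h3 : infiniteComponent F v (blockDet c _ b ⟨k, hp⟩ : (AdeleRing (𝓞 F) F)ˣ) *
        infiniteComponent F v (blockDet c _ b ⟨k⁻¹, inv_mem hp⟩ : (AdeleRing (𝓞 F) F)ˣ) = 1 := by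
      rw [← map_mul, ← Units.val_mul, hmul, Units.val_one, map_one]
    rw [h2] at h3
    have h4 := congrArg norm h3
    rw [norm_mul, norm_star, norm_one] at h4
    rw [(pow_eq_one_iff_of_nonneg (norm_nonneg _) two_ne_zero).1 ((sq _).trans h4), one_pow]

end Adeles

/-! ## The Harish-Chandra map -/

section HarishChandra

variable {F : Type*} [Field F] [NumberField F] {n : ℕ}

/-- The Harish-Chandra map `H_P : GL(n, 𝔸) → a_P = Hom(X^*(P), ℝ)`: if `g = p k` is an Iwasawa
decomposition, with `p ∈ P(𝔸)` and `k ∈ K`, then `H_P(g)` sends the character `det_b` to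
`log |det_b(p)|`. -/
def harishChandra (c : Composition n)
    (g : Matrix.GeneralLinearGroup (Fin n) (AdeleRing (𝓞 F) F)) : Fin c.length → ℝ :=
  open Classical in
  if h : ∃ p : parabolic c (AdeleRing (𝓞 F) F), ∃ k ∈ maxCompact F n, g = p * k then
    fun b => Real.log (ideleNorm (blockDet c _ b h.choose))
  else 0

/-- `H_P(g)` does not depend on the Iwasawa decomposition of `g`. -/
theorem harishChandra_eq (c : Composition n) (p : parabolic c (AdeleRing (𝓞 F) F))
    {k : Matrix.GeneralLinearGroup (Fin n) (AdeleRing (𝓞 F) F)} (hk : k ∈ maxCompact F n)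
    (b : Fin c.length) :
    harishChandra c ((p : Matrix.GeneralLinearGroup (Fin n) (AdeleRing (𝓞 F) F)) * k) b =
      Real.log (ideleNorm (blockDet c _ b p)) := by
  have h : ∃ q : parabolic c (AdeleRing (𝓞 F) F), ∃ l ∈ maxCompact F n,
      (p : Matrix.GeneralLinearGroup (Fin n) (AdeleRing (𝓞 F) F)) * k = q * l := ⟨p, k, hk, rfl⟩
  rw [harishChandra, dif_pos h]
  obtain ⟨l, hl, heq⟩ := h.choose_spec
  generalize h.choose = q at heq ⊢
  have hq : ((p⁻¹ * q : parabolic c (AdeleRing (𝓞 F) F)) :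
      Matrix.GeneralLinearGroup (Fin n) (AdeleRing (𝓞 F) F)) = k * l⁻¹ := by
    rw [Subgroup.coe_mul, Subgroup.coe_inv, inv_mul_eq_iff_eq_mul, ← mul_assoc, heq,
      mul_inv_cancel_right]
  have h1 : ideleNorm (blockDet c _ b (p⁻¹ * q)) = 1 :=
    ideleNorm_blockDet_of_mem_maxCompact c b (p⁻¹ * q).2 (hq ▸ mul_mem hk (inv_mem hl))
  have h2 : q = p * (p⁻¹ * q) := (mul_inv_cancel_left p q).symm
  rw [h2, map_mul, ideleNorm_mul, h1, mul_one]

/-- The diagonal embedding `GL(n, F) → GL(n, 𝔸)`. -/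
def diag : Matrix.GeneralLinearGroup (Fin n) F →*
    Matrix.GeneralLinearGroup (Fin n) (AdeleRing (𝓞 F) F) :=
  Matrix.GeneralLinearGroup.map (algebraMap F (AdeleRing (𝓞 F) F))

/-- `H_P` is invariant under left translation by `P(F)`. -/
theorem harishChandra_diag_mul (c : Composition n) (γ : parabolic c F)
    (g : Matrix.GeneralLinearGroup (Fin n) (AdeleRing (𝓞 F) F)) :
    harishChandra c (diag (γ : Matrix.GeneralLinearGroup (Fin n) F) * g) = harishChandra c g := by
  set γ' : parabolic c (AdeleRing (𝓞 F) F) :=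
    ⟨diag (γ : Matrix.GeneralLinearGroup (Fin n) F), map_mem_parabolic c _ γ.2⟩ with hγ'
  have hγ : diag (γ : Matrix.GeneralLinearGroup (Fin n) F) = (γ' : Matrix.GeneralLinearGroup
    (Fin n) (AdeleRing (𝓞 F) F)) := rfl
  rw [hγ]
  by_cases h : ∃ p : parabolic c (AdeleRing (𝓞 F) F), ∃ k ∈ maxCompact F n, g = p * k
  · obtain ⟨p, k, hk, rfl⟩ := h
    ext b
    rw [← mul_assoc, ← Subgroup.coe_mul, harishChandra_eq c _ hk, harishChandra_eq c _ hk, map_mul,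
      ideleNorm_mul]
    have : blockDet c _ b γ' = Units.map (algebraMap F (AdeleRing (𝓞 F) F)).toMonoidHom
        (blockDet c F b γ) :=
      Units.ext (map_blockDet c (algebraMap F (AdeleRing (𝓞 F) F)) b γ.2)
    rw [this, ideleNorm_principal, one_mul]
  · have h' : ¬ ∃ p : parabolic c (AdeleRing (𝓞 F) F), ∃ k ∈ maxCompact F n, (γ' :
        Matrix.GeneralLinearGroup (Fin n) (AdeleRing (𝓞 F) F)) * g = p * k := by
      rintro ⟨p, k, hk, hpk⟩
      refine h ⟨γ'⁻¹ * p, k, hk, ?_⟩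
      rw [Subgroup.coe_mul, Subgroup.coe_inv, mul_assoc, ← hpk, inv_mul_cancel_left]
    rw [harishChandra, harishChandra, dif_neg h, dif_neg h']

end HarishChandra

/-! ## Instability degree and canonical pairs -/

section Canonical

variable {F : Type*} [Field F] [NumberField F] {n : ℕ}

/-- The set `P(F) \ G(F)` of classes `P(F) δ`, where `P` is the standard parabolic subgroup of
type `c`. -/
abbrev Cosets (F : Type*) [Field F] (c : Composition n) : Type _ :=
  Quotient (QuotientGroup.rightRel (parabolic c F))

variable (F n) in
/-- The pairs `(P, δ)` of a standard parabolic subgroup `P` and `δ ∈ P(F) \ G(F)`. -/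
abbrev Pair : Type _ := Σ c : Composition n, Cosets F c

/-- The real number `⟨ρ_P, H_P(δ g)⟩` attached to `g` and to a pair `(P, δ)`. -/
def rhoPairing (g : Matrix.GeneralLinearGroup (Fin n) (AdeleRing (𝓞 F) F)) (x : Pair F n) : ℝ :=
  Quotient.lift (fun δ : Matrix.GeneralLinearGroup (Fin n) F =>
      ∑ i : Fin n, rho x.1 i * inclA0 x.1 (harishChandra x.1 (diag δ * g)) i)
    (by
      intro δ δ' h
      have h' : δ' * δ⁻¹ ∈ parabolic x.1 F := QuotientGroup.rightRel_apply.1 h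
      have := harishChandra_diag_mul x.1 ⟨_, h'⟩ (diag δ * g)
      rw [← mul_assoc, ← map_mul, inv_mul_cancel_right] at this
      simp only [this])
    x.2

/-- The instability degree `deg_i(g)`: the maximum of `⟨ρ_P, H_P(δ g)⟩` over all pairs `(P, δ)`. -/
def degI (g : Matrix.GeneralLinearGroup (Fin n) (AdeleRing (𝓞 F) F)) : ℝ :=
  sSup (Set.range (rhoPairing g))

/-- The projection `P(F) \ G(F) → Q(F) \ G(F)` for `P ⊆ Q`. -/
def Cosets.proj {c c' : Composition n} (h : parabolic c F ≤ parabolic c' F) :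
    Cosets F c → Cosets F c' :=
  Quotient.map' id (fun _ _ hab =>
    QuotientGroup.rightRel_apply.2 (h (QuotientGroup.rightRel_apply.1 hab)))

/-- `(P, δ)` is a canonical pair of `g`: it attains the instability degree, and a parabolic
subgroup `Q ⊇ P` such that `(Q, δ)` attains it too is equal to `P`. -/
def IsCanonicalPair (g : Matrix.GeneralLinearGroup (Fin n) (AdeleRing (𝓞 F) F))
    (x : Pair F n) : Prop :=
  rhoPairing g x = degI g ∧
    ∀ (c : Composition n) (h : parabolic x.1 F ≤ parabolic c F),
      rhoPairing g ⟨c, Cosets.proj h x.2⟩ = degI g → c = x.1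

end Canonical

end AdelicGL

end

/-!
# Existence and uniqueness of the canonical pair

The proof is the theory of the Harder–Narasimhan filtration for `Fⁿ` (row vectors), with the
logarithmic height `L = logHeight g` of subspaces in the role of minus the degree.

*Heights.* By the Iwasawa decomposition `exists_iwasawa`, a basis `w` of a subspace `W` satisfies
`w g = D k'`, where `k'` consists of rows of a matrix in `K`, and `L W = log |det D|`. This is well
defined because minors of matrices in `K` that are ideles have adelic absolute value at most `1`
(`ideleNorm_minor_le_one`), and because of the product formula. The same bound on minors gives the
submodularity `L (X ⊔ Y) + L (X ⊓ Y) ≤ L X + L Y` (`logHeight_submodular`).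

*Polygons.* A pair `(P, δ)` is the same thing as a flag: the spans `tailSpan δ a` of the last rows
of `δ`, for `a` a boundary between blocks of `P`. The sums of the coordinates of `H_P(δ g)`
from `a` on are the heights of these spans (`polygon_of_isBoundary`), so `H_P(δ g)` encodes the
polygon through the points `(dim, L)` of the flag, and `⟨ρ_P, H_P(δ g)⟩` is the area between the
chord of this polygon and the polygon (`sum_rho_mul`). Maximizing it means finding the lowest
polygon.

*The lowest polygon.* Call `W` a minimizer for `t` if it minimizes `L - t dim`. Every polygon lies
above the supporting lines given by minimizers (`le_polygon`). The subspaces that are the greatest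
minimizer for some `t` include a chain from `0` to `Fⁿ` in which neighbours are minimizers for a
common `t` (`exists_harderNarasimhan`); the corresponding polygon lies on these lines, so it is the
lowest one and the maximum is attained. Any other flag with this polygon contains all members of
the chain (`tailSpan_eq_of_polygon_eq`), which makes the pair of the chain the only canonical one.

That minima are attained does not need the finiteness of the number of subspaces of bounded height:
it follows from submodularity alone (`exists_eq_of_submodular`, `bddBelow_of_submodular`), since two
distinct near-minimizers of the same dimension have a sum of larger dimension that is again a
near-minimizer.
-/

noncomputable section

namespace AdelicGL

open Module

/-! ### The Harder–Narasimhan filtration of a submodular function -/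

section Submodular

variable {F V : Type*} [Field F] [AddCommGroup V] [Module F V] [FiniteDimensional F V]

theorem finrank_lt_finrank_sup_of_ne {U W : Submodule F V} (h : U ≠ W)
    (hd : finrank F U = finrank F W) : finrank F U < finrank F (U ⊔ W : Submodule F V) := by
  refine Submodule.finrank_lt_finrank_of_lt (lt_of_le_of_ne le_sup_left fun he => h ?_)
  have hW : W ≤ U := he ▸ le_sup_right
  exact (Submodule.eq_of_le_of_finrank_eq hW hd.symm).symm

theorem exists_max_threshold {Q : ℕ → Prop} {n : ℕ} (h0 : Q 0) (hn : ¬ Q (n + 1)) :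
    ∃ d, Q d ∧ ¬ Q (d + 1) := by
  by_contra! h
  exact hn (Nat.rec h0 (fun k hk => h k hk) (n + 1))

/-- Submodularity forces the existence of a minimizer: no discreteness of the values is needed.
Among near-minimizers of the largest possible dimension `d`, any two distinct ones would have a sum
of dimension larger than `d`, hence of value bounded away from the infimum. -/
theorem exists_eq_of_submodular {f : Submodule F V → ℝ}
    (hf : ∀ X Y, f (X ⊔ Y) + f (X ⊓ Y) ≤ f X + f Y) {S : Set (Submodule F V)}
    (hS : ∀ X ∈ S, ∀ Y ∈ S, X ⊔ Y ∈ S) {m : ℝ} (hm : ∀ X, m ≤ f X)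
    (hinf : ∀ ε > 0, ∃ X ∈ S, f X < m + ε) : ∃ X ∈ S, f X = m := by
  obtain ⟨d, hd, hd'⟩ := exists_max_threshold (n := finrank F V)
    (Q := fun d => ∀ ε > 0, ∃ X ∈ S, d ≤ finrank F X ∧ f X < m + ε)
    (fun ε hε => by
      obtain ⟨X, hX, h⟩ := hinf ε hε
      exact ⟨X, hX, Nat.zero_le _, h⟩)
    (fun h => by
      obtain ⟨X, -, h1, -⟩ := h 1 one_pos
      have := X.finrank_le
      omega)
  push Not at hd'
  obtain ⟨η, hη, hbig⟩ := hd'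
  have hdim : ∀ X ∈ S, d ≤ finrank F X → f X < m + η / 2 → finrank F X = d := by
    intro X hX h1 h2
    by_contra hne
    have := hbig X hX (by omega)
    linarith
  obtain ⟨X, hX, hXd, hXm⟩ := hd (η / 2) (by linarith)
  by_contra! hno
  have hlt : m < f X := lt_of_le_of_ne (hm X) (hno X hX).symm
  obtain ⟨Y, hY, hYd, hYm⟩ := hd (f X - m) (by linarith)
  have hYX : f Y < f X := by linarith
  have hne : X ≠ Y := by rintro rfl; exact lt_irrefl _ hYX
  have e1 := hdim X hX hXd hXm
  have e2 := hdim Y hY hYd (by linarith)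
  have h3 := finrank_lt_finrank_sup_of_ne hne (e1.trans e2.symm)
  have h4 := hbig (X ⊔ Y) (hS X hX Y hY) (by omega)
  linarith [hf X Y, hm (X ⊓ Y)]

/-- A submodular function on the subspaces of a finite-dimensional space is bounded below.
Otherwise, let `d` be the largest dimension in which it takes arbitrarily negative values. For a
fixed `X` and a varying `Y` of dimension `d` with very negative values, the value at the larger
space `X ⊔ Y` is bounded below, and so is that at `X ⊓ Y`, by induction applied to `X`. -/
theorem bddBelow_of_submodular {f : Submodule F V → ℝ}
    (hf : ∀ X Y, f (X ⊔ Y) + f (X ⊓ Y) ≤ f X + f Y) : ∃ m, ∀ X, m ≤ f X := by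
  suffices H : ∀ U : Submodule F V, ∃ m, ∀ X ≤ U, m ≤ f X by
    obtain ⟨m, hm⟩ := H ⊤
    exact ⟨m, fun X => hm X le_top⟩
  intro U
  induction U using WellFoundedLT.induction with
  | ind U ih =>
    by_contra! hU
    obtain ⟨d, hd, hd'⟩ := exists_max_threshold (n := finrank F U)
      (Q := fun d => ∀ N, ∃ X ≤ U, d ≤ finrank F X ∧ f X < N)
      (fun N => by
        obtain ⟨X, hX, h⟩ := hU N
        exact ⟨X, hX, Nat.zero_le _, h⟩)
      (fun h => by
        obtain ⟨X, hX, h1, -⟩ := h 1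
        have := Submodule.finrank_mono hX
        omega)
    push Not at hd'
    obtain ⟨C, hC⟩ := hd'
    have hdim : ∀ X ≤ U, d ≤ finrank F X → f X < C → finrank F X = d := by
      intro X hX h1 h2
      by_contra hne
      have := hC X hX (by omega)
      linarith
    obtain ⟨X, hX, hXd, hXC⟩ := hd C
    have e1 := hdim X hX hXd hXC
    have hXU : X < U := by
      refine lt_of_le_of_ne hX ?_
      rintro rfl
      obtain ⟨Y, hY, hYd, hYC⟩ := hd (f X)
      have : Y = X := Submodule.eq_of_le_of_finrank_le hY (by omega)
      exact lt_irrefl _ (this ▸ hYC)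
    obtain ⟨B, hB⟩ := ih X hXU
    obtain ⟨Y, hY, hYd, hYC⟩ := hd (min (f X) (C + B - f X))
    have hY1 : f Y < f X := hYC.trans_le (min_le_left _ _)
    have hY2 : f Y < C + B - f X := hYC.trans_le (min_le_right _ _)
    have hne : X ≠ Y := by rintro rfl; exact lt_irrefl _ hY1
    have e2 := hdim Y hY hYd (by linarith)
    have h3 := finrank_lt_finrank_sup_of_ne hne (e1.trans e2.symm)
    have h4 := hC (X ⊔ Y) (sup_le hX hY) (by omega)
    linarith [hf X Y, hB (X ⊓ Y) inf_le_left]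

/-- The function `L - t dim` on subspaces. -/
def tilt (L : Submodule F V → ℝ) (t : ℝ) (W : Submodule F V) : ℝ := L W - t * finrank F W

/-- `W` minimizes `L - t dim`. -/
def IsMinimizer (L : Submodule F V → ℝ) (t : ℝ) (W : Submodule F V) : Prop :=
  ∀ X, tilt L t W ≤ tilt L t X

/-- `W` is the greatest minimizer of `L - t dim`. -/
def IsGreatestMinimizer (L : Submodule F V → ℝ) (t : ℝ) (W : Submodule F V) : Prop :=
  IsMinimizer L t W ∧ ∀ X, IsMinimizer L t X → X ≤ W

variable {L : Submodule F V → ℝ}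

theorem tilt_submodular (hL : ∀ X Y, L (X ⊔ Y) + L (X ⊓ Y) ≤ L X + L Y) (t : ℝ)
    (X Y : Submodule F V) : tilt L t (X ⊔ Y) + tilt L t (X ⊓ Y) ≤ tilt L t X + tilt L t Y := by
  have h : (finrank F (X ⊔ Y : Submodule F V) : ℝ) + finrank F (X ⊓ Y : Submodule F V)
      = finrank F X + finrank F Y := by exact_mod_cast Submodule.finrank_sup_add_finrank_inf_eq X Y
  have h' := congrArg (t * ·) h
  simp only [mul_add] at h'
  unfold tilt
  linarith [hL X Y]

theorem IsMinimizer.sup (hL : ∀ X Y, L (X ⊔ Y) + L (X ⊓ Y) ≤ L X + L Y) {t : ℝ}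
    {X Y : Submodule F V} (hX : IsMinimizer L t X) (hY : IsMinimizer L t Y) :
    IsMinimizer L t (X ⊔ Y) := by
  intro Z
  linarith [tilt_submodular hL t X Y, hX (X ⊓ Y), hY Z]

theorem IsMinimizer.exists_greatest (hL : ∀ X Y, L (X ⊔ Y) + L (X ⊓ Y) ≤ L X + L Y) {t : ℝ}
    {X : Submodule F V} (hX : IsMinimizer L t X) : ∃ W, IsGreatestMinimizer L t W := by
  obtain ⟨W, hW, hmax⟩ := wellFounded_gt.has_min {W : Submodule F V | IsMinimizer L t W} ⟨X, hX⟩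
  refine ⟨W, hW, fun Y hY => ?_⟩
  have h := hmax (W ⊔ Y) (IsMinimizer.sup hL hW hY)
  exact sup_eq_left.1 (((le_sup_left : W ≤ W ⊔ Y).eq_or_lt.resolve_right h).symm)

/-- The next vertex of the Harder–Narasimhan polygon: the edge that leaves `W` has the least slope
`t'` of all quotients `X / W`, and it ends in the greatest minimizer of `L - t' dim`. -/
theorem IsGreatestMinimizer.exists_next (hL : ∀ X Y, L (X ⊔ Y) + L (X ⊓ Y) ≤ L X + L Y) {t : ℝ}
    {W : Submodule F V} (hW : IsGreatestMinimizer L t W) (hne : W ≠ ⊤) :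
    ∃ t' W', W < W' ∧ IsMinimizer L t' W ∧ IsGreatestMinimizer L t' W' := by
  have hpos : ∀ X, W < X → (0 : ℝ) < finrank F X - finrank F W := fun X hX =>
    sub_pos.2 (Nat.cast_lt.2 (Submodule.finrank_lt_finrank_of_lt hX))
  let sl : Submodule F V → ℝ := fun X => (L X - L W) / (finrank F X - finrank F W)
  have hsl : ∀ X, W < X → t < sl X := by
    intro X hX
    have h1 : tilt L t W < tilt L t X := by
      refine lt_of_not_ge fun hle => ?_
      exact absurd (hW.2 X fun Z => hle.trans (hW.1 Z)) (not_le_of_gt hX)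
    unfold tilt at h1
    rw [lt_div_iff₀ (hpos X hX)]
    linarith
  have hneT : (sl '' {X | W < X}).Nonempty := ⟨_, ⊤, lt_top_iff_ne_top.2 hne, rfl⟩
  have hbdd : BddBelow (sl '' {X | W < X}) := ⟨t, by
    rintro _ ⟨X, hX, rfl⟩
    exact (hsl X hX).le⟩
  set t' := sInf (sl '' {X | W < X}) with ht'
  have htt' : t ≤ t' := le_csInf hneT (by
    rintro _ ⟨X, hX, rfl⟩
    exact (hsl X hX).le)
  have hup : ∀ X, W < X → tilt L t' W ≤ tilt L t' X := by
    intro X hX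
    have h1 : t' ≤ sl X := csInf_le hbdd ⟨X, hX, rfl⟩
    rw [le_div_iff₀ (hpos X hX)] at h1
    unfold tilt
    linarith
  have hdown : ∀ X ≤ W, tilt L t' W ≤ tilt L t' X := by
    intro X hX
    have h1 := hW.1 X
    have h2 : (0 : ℝ) ≤ finrank F W - finrank F X :=
      sub_nonneg.2 (Nat.cast_le.2 (Submodule.finrank_mono hX))
    have h3 := mul_nonneg (sub_nonneg.2 htt') h2
    unfold tilt at h1 ⊢
    linarith
  have hmin : IsMinimizer L t' W := by
    intro X
    have h1 := tilt_submodular hL t' X W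
    have h2 : tilt L t' W ≤ tilt L t' (X ⊔ W) := by
      rcases (le_sup_right : W ≤ X ⊔ W).eq_or_lt with h | h
      · rw [← h]
      · exact hup _ h
    linarith [hdown (X ⊓ W) inf_le_right]
  obtain ⟨X, hX, hXeq⟩ := exists_eq_of_submodular (tilt_submodular hL t') (S := {X | W < X})
    (fun X (hX : W < X) Y _ => show W < X ⊔ Y from hX.trans_le le_sup_left) hmin (by
      intro ε hε
      have hn : (0 : ℝ) < finrank F V + 1 := by positivity
      obtain ⟨_, ⟨X, hX, rfl⟩, hlt⟩ := exists_lt_of_csInf_lt hneT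
        (show sInf (sl '' {X | W < X}) < t' + ε / (finrank F V + 1) by
          have : 0 < ε / (finrank F V + 1 : ℝ) := by positivity
          linarith)
      refine ⟨X, hX, ?_⟩
      have h1 := (div_lt_iff₀ (hpos X hX)).1 hlt
      have h2 : ε / (finrank F V + 1 : ℝ) * (finrank F X - finrank F W) < ε := by
        rw [div_mul_eq_mul_div, div_lt_iff₀ hn]
        refine mul_lt_mul_of_pos_left ?_ hε
        have : (finrank F X : ℝ) ≤ finrank F V := Nat.cast_le.2 X.finrank_le
        have : (0 : ℝ) ≤ finrank F W := Nat.cast_nonneg _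
        linarith
      unfold tilt
      linarith)
  have hXmin : IsMinimizer L t' X := fun Z => hXeq.le.trans (hmin Z)
  obtain ⟨W', hW'⟩ := hXmin.exists_greatest hL
  exact ⟨t', W', lt_of_lt_of_le hX (hW'.2 X hXmin), hmin, hW'⟩

/-- The part above `W` of the Harder–Narasimhan filtration. -/
theorem IsGreatestMinimizer.exists_chain (hL : ∀ X Y, L (X ⊔ Y) + L (X ⊓ Y) ≤ L X + L Y)
    (W : Submodule F V) : ∀ t, IsGreatestMinimizer L t W →
    ∃ S : Set (Submodule F V), S.Finite ∧ IsChain (· ≤ ·) S ∧ W ∈ S ∧ ⊤ ∈ S ∧ (∀ U ∈ S, W ≤ U) ∧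
      (∀ U ∈ S, ∃ s, IsGreatestMinimizer L s U) ∧
      ∀ U ∈ S, ∀ U' ∈ S, U < U' → (∀ X ∈ S, U < X → ¬ X < U') →
        ∃ s, IsMinimizer L s U ∧ IsMinimizer L s U' := by
  induction W using WellFoundedGT.induction with
  | ind W ih =>
    intro t hW
    by_cases hne : W = ⊤
    · subst hne
      refine ⟨{⊤}, Set.finite_singleton _, IsChain.singleton, rfl, rfl, by simp, ?_, ?_⟩
      · rintro U rfl
        exact ⟨t, hW⟩
      · rintro U rfl U' rfl h
        exact absurd h (lt_irrefl _)
    · obtain ⟨t', W', hlt, hWm, hW'⟩ := hW.exists_next hL hne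
      obtain ⟨S, hfin, hch, hW'S, htop, hle, hgr, hcons⟩ := ih W' hlt t' hW'
      have hWlt : ∀ U ∈ S, W < U := fun U hU => hlt.trans_le (hle U hU)
      refine ⟨insert W S, hfin.insert W, hch.insert fun U hU _ => Or.inl (hWlt U hU).le,
        Set.mem_insert _ _, Set.mem_insert_of_mem _ htop, ?_, ?_, ?_⟩
      · rintro U (rfl | hU)
        exacts [le_rfl, (hWlt U hU).le]
      · rintro U (rfl | hU)
        exacts [⟨t, hW⟩, hgr U hU]
      · rintro U (rfl | hU) U' (rfl | hU') hUU' hno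
        · exact absurd hUU' (lt_irrefl _)
        · rcases (hle U' hU').eq_or_lt with rfl | h
          · exact ⟨t', hWm, hW'.1⟩
          · exact absurd h (hno W' (Set.mem_insert_of_mem _ hW'S) hlt)
        · exact absurd hUU' (hWlt U hU).not_gt
        · exact hcons U hU U' hU' hUU' fun X hX => hno X (Set.mem_insert_of_mem _ hX)

/-- The Harder–Narasimhan filtration of a submodular function `L` with `L(0) = 0`. -/
theorem exists_harderNarasimhan (hL : ∀ X Y, L (X ⊔ Y) + L (X ⊓ Y) ≤ L X + L Y)
    (h0 : L ⊥ = 0) :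
    ∃ S : Set (Submodule F V), S.Finite ∧ IsChain (· ≤ ·) S ∧ ⊥ ∈ S ∧ ⊤ ∈ S ∧
      (∀ U ∈ S, ∃ s, IsGreatestMinimizer L s U) ∧
      ∀ U ∈ S, ∀ U' ∈ S, U < U' → (∀ X ∈ S, U < X → ¬ X < U') →
        ∃ s, IsMinimizer L s U ∧ IsMinimizer L s U' := by
  obtain ⟨m, hm⟩ := bddBelow_of_submodular hL
  -- For `t` below all values of `L`, and `t < 0`, the zero subspace is the only minimizer.
  have hm0 : m ≤ 0 := h0 ▸ hm ⊥
  have hpos : ∀ X : Submodule F V, X ≠ ⊥ → tilt L (m - 1) ⊥ < tilt L (m - 1) X := by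
    intro X hX
    have h1 : (1 : ℝ) ≤ finrank F X := by
      exact_mod_cast Nat.one_le_iff_ne_zero.2 (mt Submodule.finrank_eq_zero.1 hX)
    unfold tilt
    rw [h0, finrank_bot]
    push_cast
    nlinarith [hm X]
  have hbot : IsGreatestMinimizer L (m - 1) ⊥ := by
    refine ⟨fun X => ?_, fun X hX => ?_⟩
    · by_cases h : X = ⊥
      · rw [h]
      · exact (hpos X h).le
    · by_contra h
      exact absurd (hX ⊥) (not_le_of_gt (hpos X fun he => h he.le))
  obtain ⟨S, h1, h2, h3, h4, -, h5, h6⟩ := hbot.exists_chain hL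
  exact ⟨S, h1, h2, h3, h4, h5, h6⟩

end Submodular

/-! ### Adapted bases -/

section AdaptedBases

variable {F V : Type*} [Field F] [AddCommGroup V] [Module F V]

theorem span_inter_eq_of_subset {b s : Set V} {W : Submodule F V} (hs : s ⊆ b)
    (hW : Submodule.span F s = W) : Submodule.span F (b ∩ W) = W := by
  refine le_antisymm (Submodule.span_le.2 Set.inter_subset_right) ?_
  nth_rewrite 1 [← hW]
  exact Submodule.span_mono fun v hv => ⟨hs hv, hW ▸ Submodule.subset_span hv⟩

theorem exists_extension_spanning {s : Set V} (hs : LinearIndepOn F id s) {W : Submodule F V}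
    (hsW : s ⊆ W) : ∃ b : Set V, s ⊆ b ∧ LinearIndepOn F id b ∧ Submodule.span F b = W := by
  obtain ⟨b, h1, h2, h3, h4⟩ := exists_linearIndepOn_id_extension hs hsW
  exact ⟨b, h2, h4, le_antisymm (Submodule.span_le.2 h1) h3⟩

/-- A finite chain of subspaces has an adapted basis. -/
theorem exists_adapted_of_chain (S : Finset (Submodule F V))
    (hS : IsChain (· ≤ ·) (S : Set (Submodule F V))) :
    ∃ b : Set V, LinearIndepOn F id b ∧ (∀ v ∈ b, ∃ W ∈ S, v ∈ W) ∧
      ∀ W ∈ S, Submodule.span F (b ∩ W) = W := by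
  classical
  induction S using Finset.strongInduction with
  | H S ih =>
    rcases S.eq_empty_or_nonempty with rfl | hne
    · exact ⟨∅, linearIndepOn_empty F id, by simp, by simp⟩
    obtain ⟨M, hM⟩ := S.exists_maximal hne
    have hle : ∀ W ∈ S, W ≤ M := by
      intro W hW
      rcases eq_or_ne W M with h | h
      · exact h.le
      · rcases hS hW hM.1 h with h' | h'
        · exact h'
        · exact hM.2 hW h'
    obtain ⟨b, hb, hbS, hbW⟩ := ih (S.erase M) (Finset.erase_ssubset hM.1)
      (hS.mono fun W hW => Finset.mem_of_mem_erase hW)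
    obtain ⟨b', hbb', hb', hspan⟩ := exists_extension_spanning hb (W := M) (by
      intro v hv
      obtain ⟨W, hW, hvW⟩ := hbS v hv
      exact hle W (Finset.mem_of_mem_erase hW) hvW)
    refine ⟨b', hb', fun v hv => ⟨M, hM.1, hspan ▸ Submodule.subset_span hv⟩, fun W hW => ?_⟩
    rcases eq_or_ne W M with rfl | h
    · exact span_inter_eq_of_subset subset_rfl hspan
    · exact span_inter_eq_of_subset (Set.inter_subset_left.trans hbb')
        (hbW W (Finset.mem_erase.2 ⟨h, hW⟩))

/-- Two subspaces have a common adapted basis, which is then adapted to their sum and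
intersection. -/
theorem exists_adapted_of_pair (X Y : Submodule F V) :
    ∃ b : Set V, LinearIndepOn F id b ∧ Submodule.span F b = ⊤ ∧
      Submodule.span F (b ∩ (X ⊓ Y : Submodule F V)) = X ⊓ Y ∧ Submodule.span F (b ∩ X) = X ∧
      Submodule.span F (b ∩ Y) = Y ∧
      Submodule.span F (b ∩ (X ⊔ Y : Submodule F V)) = X ⊔ Y ∧
      ∀ v ∈ b, v ∈ X ⊔ Y → v ∈ X ∨ v ∈ Y := by
  obtain ⟨b₀, -, hb₀, hs₀⟩ := exists_extension_spanning (linearIndepOn_empty F (id : V → V))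
    (W := X ⊓ Y) (Set.empty_subset _)
  obtain ⟨bY, h₀Y, hbY, hsY⟩ := exists_extension_spanning hb₀ (W := Y)
    (fun v hv => (hs₀ ▸ Submodule.subset_span hv : v ∈ X ⊓ Y).2)
  -- A complement `C` of `X ⊓ Y` in `X` is disjoint from `Y`.
  obtain ⟨D, hD⟩ := Submodule.exists_isCompl (X ⊓ Y)
  obtain ⟨bC, -, hbC, hsC⟩ := exists_extension_spanning (linearIndepOn_empty F (id : V → V))
    (W := D ⊓ X) (Set.empty_subset _)
  have hX : X ⊓ Y ⊔ D ⊓ X = X := by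
    rw [← sup_inf_assoc_of_le D (inf_le_left : X ⊓ Y ≤ X), hD.sup_eq_top, top_inf_eq]
  have hdisj : Disjoint Y (D ⊓ X) := by
    rw [disjoint_iff, ← le_bot_iff, ← hD.inf_eq_bot]
    exact le_inf (le_inf (inf_le_right.trans inf_le_right) inf_le_left)
      (inf_le_right.trans inf_le_left)
  have hun : LinearIndepOn F id (bY ∪ bC) := hbY.id_union hbC (by rwa [hsY, hsC])
  obtain ⟨b, hsub, hb, hspan⟩ := exists_extension_spanning hun (W := ⊤) (Set.subset_univ _)
  have hYb := Set.subset_union_left.trans hsub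
  have hCb := Set.subset_union_right.trans hsub
  have hspanS : Submodule.span F (bY ∪ bC) = X ⊔ Y := by
    rw [Submodule.span_union, hsY, hsC]
    conv_rhs => rw [← hX, sup_right_comm, sup_eq_right.2 (inf_le_right : X ⊓ Y ≤ Y)]
  refine ⟨b, hb, hspan, span_inter_eq_of_subset (h₀Y.trans hYb) hs₀,
    span_inter_eq_of_subset (s := b₀ ∪ bC) (Set.union_subset (h₀Y.trans hYb) hCb) ?_,
    span_inter_eq_of_subset hYb hsY, span_inter_eq_of_subset hsub hspanS, fun v hv hvS => ?_⟩
  · rw [Submodule.span_union, hs₀, hsC, hX]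
  · by_contra hno
    have hv' : v ∉ bY ∪ bC := by
      rintro (h | h)
      · exact hno (Or.inr (hsY ▸ Submodule.subset_span h))
      · exact hno (Or.inl (hsC ▸ Submodule.subset_span h : v ∈ D ⊓ X).2)
    have h := LinearIndependent.notMem_span_image (v := ((↑) : b → V)) hb
      (s := ((↑) : b → V) ⁻¹' (bY ∪ bC)) (x := ⟨v, hv⟩) hv'
    rw [Set.image_preimage_eq_of_subset (by rwa [Subtype.range_coe]), hspanS] at h
    exact h hvS

end AdaptedBases

/-! ### Flags spanned by the rows of a matrix -/

section Rows

variable {F : Type*} [Field F] {n : ℕ}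

theorem GL_rows_linearIndependent (δ : Matrix.GeneralLinearGroup (Fin n) F) :
    LinearIndependent F (fun i => (δ : Matrix (Fin n) (Fin n) F) i) :=
  Matrix.linearIndependent_rows_iff_isUnit.2 δ.isUnit

/-- A basis of `Fⁿ` is the set of rows of an invertible matrix, and the rows can be sorted by any
weight. -/
theorem exists_GL_rows {b : Set (Fin n → F)} (hb : LinearIndepOn F id b)
    (hspan : Submodule.span F b = ⊤) (f : (Fin n → F) → ℕ) :
    ∃ δ : Matrix.GeneralLinearGroup (Fin n) F,
      Set.range (fun i => (δ : Matrix (Fin n) (Fin n) F) i) = b ∧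
      Monotone fun i => f ((δ : Matrix (Fin n) (Fin n) F) i) := by
  have B : Basis b F (Fin n → F) := Basis.mk (v := ((↑) : b → Fin n → F)) hb (by
    rw [Subtype.range_coe, hspan])
  have : Finite b := Module.Finite.finite_basis B
  have : Fintype b := Fintype.ofFinite b
  have hcard : Fintype.card b = n := by
    rw [← finrank_span_set_eq_card hb |>.trans (Set.toFinset_card b), hspan, finrank_top,
      finrank_fin_fun]
  let e : Fin n ≃ b := (finCongr hcard.symm).trans (Fintype.equivFin b).symm
  let e' : Fin n ≃ b := (Tuple.sort (fun i => f (e i))).trans e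
  have hli : LinearIndependent F (fun i => ((e' i : b) : Fin n → F)) :=
    LinearIndependent.comp (v := ((↑) : b → Fin n → F)) hb e' e'.injective
  let A : Matrix (Fin n) (Fin n) F := Matrix.of fun i => ((e' i : b) : Fin n → F)
  have hA : IsUnit A := Matrix.linearIndependent_rows_iff_isUnit.1 hli
  refine ⟨hA.unit, ?_, Tuple.monotone_sort (fun i => f (e i))⟩
  change Set.range (((↑) : b → Fin n → F) ∘ e') = b
  rw [e'.surjective.range_comp, Subtype.range_coe]

/-- The span of the rows of `δ` of index at least `a`. If `a` is a boundary between blocks of a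
standard parabolic subgroup `P`, it depends only on the class of `δ` in `P(F) \ G(F)`. -/
def tailSpan (δ : Matrix.GeneralLinearGroup (Fin n) F) (a : ℕ) : Submodule F (Fin n → F) :=
  Submodule.span F (Set.range fun i : {i : Fin n // a ≤ i} => (δ : Matrix (Fin n) (Fin n) F) i)

theorem span_rows_eq (δ : Matrix.GeneralLinearGroup (Fin n) F) {W : Submodule F (Fin n → F)}
    {b : Set (Fin n → F)} (hδ : Set.range (fun i => (δ : Matrix (Fin n) (Fin n) F) i) = b)
    (hW : Submodule.span F (b ∩ W) = W) {p : Fin n → Prop}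
    (hp : ∀ i, p i ↔ (δ : Matrix (Fin n) (Fin n) F) i ∈ W) :
    Submodule.span F (Set.range fun i : {i : Fin n // p i} => (δ : Matrix (Fin n) (Fin n) F) i)
      = W := by
  rw [← hW]
  congr 1
  ext v
  constructor
  · rintro ⟨i, rfl⟩
    exact ⟨hδ ▸ ⟨i.1, rfl⟩, (hp i).1 i.2⟩
  · rintro ⟨hv, hvW⟩
    rw [← hδ] at hv
    obtain ⟨i, rfl⟩ := hv
    exact ⟨⟨i, (hp i).2 hvW⟩, rfl⟩

theorem finrank_span_rows (δ : Matrix.GeneralLinearGroup (Fin n) F) (p : Fin n → Prop)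
    [DecidablePred p] : finrank F (Submodule.span F (Set.range fun i : {i : Fin n // p i} =>
      (δ : Matrix (Fin n) (Fin n) F) i)) = Fintype.card {i // p i} :=
  finrank_span_eq_card
    (LinearIndependent.comp (GL_rows_linearIndependent δ) Subtype.val Subtype.val_injective)

theorem card_tail (a : ℕ) : Fintype.card {i : Fin n // a ≤ i} = n - a := by
  rw [Fintype.card_subtype]
  rcases lt_or_ge a n with h | h
  · rw [← Fin.card_Ici ⟨a, h⟩]
    congr 1
    ext i
    simp [Fin.le_def]
  · rw [Nat.sub_eq_zero_of_le h, Finset.card_eq_zero, Finset.filter_eq_empty_iff]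
    intro i _
    have := i.2
    omega

theorem finrank_tailSpan (δ : Matrix.GeneralLinearGroup (Fin n) F) (a : ℕ) :
    finrank F (tailSpan δ a) = n - a := by
  rw [tailSpan, finrank_span_rows δ (fun i => a ≤ (i : ℕ)), card_tail]

theorem tailSpan_zero (δ : Matrix.GeneralLinearGroup (Fin n) F) : tailSpan δ 0 = ⊤ :=
  Submodule.eq_top_of_finrank_eq (by rw [finrank_tailSpan, finrank_fin_fun, Nat.sub_zero])

theorem mem_upperSet_iff {p : Fin n → Prop} [DecidablePred p] (hp : ∀ i j, i ≤ j → p i → p j)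
    (i : Fin n) : p i ↔ n - Fintype.card {i // p i} ≤ i := by
  rw [Fintype.card_subtype]
  constructor
  · intro hi
    have : (Finset.Ici i).card ≤ (Finset.univ.filter fun x => p x).card :=
        Finset.card_le_card fun j hj => by
      simpa using hp i j (Finset.mem_Ici.1 hj) hi
    rw [Fin.card_Ici] at this
    omega
  · intro hle
    by_contra hi
    have : (Finset.univ.filter fun x => p x).card ≤ (Finset.Ioi i).card :=
        Finset.card_le_card fun j hj => by
      refine Finset.mem_Ioi.2 (lt_of_not_ge fun h => hi (hp j i h ?_))
      simpa using hj
    rw [Fin.card_Ioi] at this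
    have := i.2
    omega

/-- A finite chain of subspaces of `Fⁿ` consists of spans of the last rows of one matrix. -/
theorem exists_GL_tailSpan {S : Set (Submodule F (Fin n → F))} (hfin : S.Finite)
    (hch : IsChain (· ≤ ·) S) (htop : ⊤ ∈ S) :
    ∃ δ : Matrix.GeneralLinearGroup (Fin n) F, ∀ W ∈ S, tailSpan δ (n - finrank F W) = W := by
  classical
  lift S to Finset (Submodule F (Fin n → F)) using hfin
  obtain ⟨b, hb, -, hbW⟩ := exists_adapted_of_chain S hch
  have hspan : Submodule.span F b = ⊤ := by
    rw [← hbW ⊤ htop, Submodule.top_coe, Set.inter_univ]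
  obtain ⟨δ, hδ, hmono⟩ := exists_GL_rows hb hspan fun v => (S.filter fun W => v ∈ W).card
  refine ⟨δ, fun W hW => ?_⟩
  have hup : ∀ i j : Fin n, i ≤ j → (δ : Matrix (Fin n) (Fin n) F) i ∈ W →
      (δ : Matrix (Fin n) (Fin n) F) j ∈ W := by
    intro i j hij hi
    by_contra hj
    -- Otherwise row `j` lies in fewer members of the chain than row `i`.
    refine absurd (hmono hij) (not_le_of_gt (Finset.card_lt_card ?_))
    refine (Finset.ssubset_iff_of_subset fun U hU => ?_).2 ⟨W, ?_, ?_⟩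
    · simp only [Finset.mem_filter] at hU ⊢
      refine ⟨hU.1, ?_⟩
      rcases eq_or_ne U W with rfl | hne
      · exact hi
      · rcases hch hU.1 hW hne with h | h
        · exact absurd (h hU.2) hj
        · exact h hi
    · simp only [Finset.mem_filter]
      exact ⟨hW, hi⟩
    · simp only [Finset.mem_filter]
      exact fun h => hj h.2
  have h1 := span_rows_eq δ hδ (hbW W hW) (p := fun i => (δ : Matrix (Fin n) (Fin n) F) i ∈ W)
    fun i => Iff.rfl
  have h2 := finrank_span_rows δ fun i => (δ : Matrix (Fin n) (Fin n) F) i ∈ W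
  rw [h1] at h2
  refine span_rows_eq δ hδ (hbW W hW) fun i => ?_
  rw [h2]
  exact (mem_upperSet_iff hup i).symm

end Rows

/-! ### The local Iwasawa decompositions -/

section LocalIwasawa

variable {n : ℕ}

/-- The elementary unipotent matrix `1 + u wᵀ` with `w · u = 0`. -/
def unipotent {R : Type*} [CommRing R] (u w : Fin n → R) (h : w ⬝ᵥ u = 0) :
    Matrix.GeneralLinearGroup (Fin n) R where
  val := 1 + Matrix.vecMulVec u w
  inv := 1 - Matrix.vecMulVec u w
  val_inv := by
    have : Matrix.vecMulVec u w * Matrix.vecMulVec u w = 0 := by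
      rw [Matrix.vecMulVec_mul_vecMulVec, h, zero_smul, Matrix.vecMulVec_zero]
    rw [add_mul, mul_sub, mul_sub, this]
    simp
  inv_val := by
    have : Matrix.vecMulVec u w * Matrix.vecMulVec u w = 0 := by
      rw [Matrix.vecMulVec_mul_vecMulVec, h, zero_smul, Matrix.vecMulVec_zero]
    rw [sub_mul, mul_add, mul_add, this]
    simp

variable {K : Type*} [Field K] (A : ValuationSubring K)

/-- The inclusion `GL(n, A) → GL(n, K)`. -/
abbrev inclGL : Matrix.GeneralLinearGroup (Fin n) A →* Matrix.GeneralLinearGroup (Fin n) K :=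
  Matrix.GeneralLinearGroup.map A.subtype

theorem vecMul_unipotent (u w : Fin n → A) (h : w ⬝ᵥ u = 0) (r : Fin n → K) (j : Fin n) :
    Matrix.vecMul r (inclGL A (unipotent u w h) : Matrix (Fin n) (Fin n) K) j
      = r j + (∑ i, r i * (u i : K)) * (w j : K) := by
  have : (inclGL A (unipotent u w h) : Matrix (Fin n) (Fin n) K) =
      1 + Matrix.vecMulVec (fun i => (u i : K)) (fun i => (w i : K)) := by
    ext i j
    simp [unipotent, Matrix.vecMulVec_apply, Matrix.one_apply, apply_ite]
  rw [this, Matrix.vecMul_add, Matrix.vecMul_one, Matrix.vecMul_vecMulVec]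
  simp [dotProduct]

/-- Integral column operations among the first `a + 1` columns make the entry at `a` divide all
earlier ones. -/
theorem exists_dominating (r : Fin n → K) (a : Fin n) :
    ∃ m : Matrix.GeneralLinearGroup (Fin n) A,
      (∀ j ≤ a, ∃ c : A, Matrix.vecMul r (inclGL A m : Matrix (Fin n) (Fin n) K) j
        = c * Matrix.vecMul r (inclGL A m : Matrix (Fin n) (Fin n) K) a) ∧
      ∀ s : Fin n → K, (∀ j ≤ a, s j = 0) →
        Matrix.vecMul s (inclGL A m : Matrix (Fin n) (Fin n) K) = s := by
  obtain ⟨p, hpa, hp⟩ := Finset.exists_max_image (Finset.Iic a) (fun j => A.valuation (r j))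
    ⟨a, Finset.mem_Iic.2 le_rfl⟩
  rw [Finset.mem_Iic] at hpa
  have hdiv : ∀ j ≤ a, ∃ c : A, r j = c * r p := by
    intro j hj
    have h1 := hp j (Finset.mem_Iic.2 hj)
    by_cases h0 : r p = 0
    · refine ⟨0, ?_⟩
      rw [h0, map_zero, le_zero_iff, map_eq_zero] at h1
      simp [h1]
    · refine ⟨⟨r j / r p, (A.valuation_le_one_iff _).1 ?_⟩, ?_⟩
      · rw [map_div₀]
        exact div_le_one_of_le₀ h1 zero_le
      · exact (div_mul_cancel₀ _ h0).symm
  obtain ⟨c, hc⟩ := hdiv a le_rfl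
  rcases eq_or_ne p a with rfl | hne
  · exact ⟨1, by simpa using hdiv, fun s _ => by simp⟩
  by_cases hu : IsUnit c
  · obtain ⟨c, rfl⟩ := hu
    refine ⟨1, fun j hj => ?_, fun s _ => by simp⟩
    obtain ⟨d, hd⟩ := hdiv j hj
    refine ⟨d * (c⁻¹ : Aˣ), ?_⟩
    have hcc : (((c⁻¹ : Aˣ) : A) : K) * ((c : A) : K) = 1 := by
      exact_mod_cast congrArg (Subtype.val) c.inv_mul
    simp only [map_one, Units.val_one, Matrix.vecMul_one, MulMemClass.coe_mul]
    rw [hd, hc]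
    linear_combination (-(d : K) * r p) * hcc
  · -- If `r a / r p` is not a unit, then `1 + r a / r p` is one.
    obtain ⟨e, he⟩ := (IsLocalRing.isUnit_or_isUnit_of_isUnit_add (a := 1 + c) (b := -c)
      (by simp)).resolve_right fun h => hu (by simpa using h.neg)
    have hcc : (((e⁻¹ : Aˣ) : A) : K) * (1 + (c : K)) = 1 := by
      have := congrArg (Subtype.val) e.inv_mul
      rw [he] at this
      exact_mod_cast this
    have hval : ∀ (s : Fin n → K) (j : Fin n), Matrix.vecMul s (inclGL A (unipotent (Pi.single p 1)
        (Pi.single a 1) (by simp [hne.symm])) : Matrix (Fin n) (Fin n) K) j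
          = s j + if j = a then s p else 0 := by
      intro s j
      rw [vecMul_unipotent]
      by_cases hj : j = a <;> simp [Pi.single_apply, apply_ite, hj]
    refine ⟨unipotent (Pi.single p 1) (Pi.single a 1) (by simp [hne.symm]), fun j hj => ?_,
      fun s hs => ?_⟩
    · rcases eq_or_ne j a with rfl | hja
      · exact ⟨1, by simp⟩
      · obtain ⟨d, hd⟩ := hdiv j hj
        refine ⟨d * (e⁻¹ : Aˣ), ?_⟩
        rw [hval, hval, if_neg hja, if_pos rfl, hd, hc, MulMemClass.coe_mul]
        linear_combination (-(d : K) * r p) * hcc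
    · ext j
      rw [hval, hs p hpa, ite_self, add_zero]

/-- Integral column operations among the first `a + 1` columns clear the entries before `a`. -/
theorem exists_clear_row (r : Fin n → K) (a : Fin n) :
    ∃ m : Matrix.GeneralLinearGroup (Fin n) A,
      (∀ j < a, Matrix.vecMul r (inclGL A m : Matrix (Fin n) (Fin n) K) j = 0) ∧
      ∀ s : Fin n → K, (∀ j ≤ a, s j = 0) →
        Matrix.vecMul s (inclGL A m : Matrix (Fin n) (Fin n) K) = s := by
  obtain ⟨m, hm, hfix⟩ := exists_dominating A r a
  set r' := Matrix.vecMul r (inclGL A m : Matrix (Fin n) (Fin n) K)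
  have hex : ∀ j : Fin n, ∃ c : A, j < a → r' j = c * r' a := by
    intro j
    by_cases hj : j < a
    · obtain ⟨c, hc⟩ := hm j hj.le
      exact ⟨c, fun _ => hc⟩
    · exact ⟨0, fun h => absurd h hj⟩
  choose c hc using hex
  let w : Fin n → A := fun j => if j < a then -c j else 0
  have hw : w ⬝ᵥ Pi.single a 1 = 0 := by simp [w]
  have hval : ∀ (s : Fin n → K) (j : Fin n), Matrix.vecMul s (inclGL A (unipotent (Pi.single a 1) w
      hw) : Matrix (Fin n) (Fin n) K) j = s j + s a * w j := by
    intro s j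
    rw [vecMul_unipotent]
    simp [Pi.single_apply, apply_ite]
  refine ⟨m * unipotent (Pi.single a 1) w hw, fun j hj => ?_, fun s hs => ?_⟩
  · rw [map_mul, Units.val_mul, ← Matrix.vecMul_vecMul, hval]
    change r' j + r' a * w j = 0
    simp only [w, if_pos hj, hc j hj, NegMemClass.coe_neg]
    ring
  · rw [map_mul, Units.val_mul, ← Matrix.vecMul_vecMul, hfix s hs]
    ext j
    rw [hval, hs a le_rfl, zero_mul, add_zero]

/-- The Iwasawa decomposition at a finite place. -/
theorem exists_integral_upperTriangular (g : Matrix (Fin n) (Fin n) K) :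
    ∃ m : Matrix.GeneralLinearGroup (Fin n) A, ∀ i j, j < i →
      (g * (inclGL A m : Matrix (Fin n) (Fin n) K)) i j = 0 := by
  suffices H : ∀ d ≤ n, ∃ m : Matrix.GeneralLinearGroup (Fin n) A, ∀ i : Fin n, n - d ≤ i →
      ∀ j < i, (g * (inclGL A m : Matrix (Fin n) (Fin n) K)) i j = 0 by
    obtain ⟨m, hm⟩ := H n le_rfl
    exact ⟨m, fun i j hij => hm i (by omega) j hij⟩
  intro d
  induction d with
  | zero =>
    intro _
    exact ⟨1, fun i hi => absurd i.2 (by omega)⟩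
  | succ d ih =>
    intro hd
    obtain ⟨m, hm⟩ := ih (by omega)
    set g' := g * (inclGL A m : Matrix (Fin n) (Fin n) K)
    obtain ⟨m', hm', hfix⟩ := exists_clear_row A (g' ⟨n - (d + 1), by omega⟩)
      ⟨n - (d + 1), by omega⟩
    refine ⟨m * m', fun i hi j hj => ?_⟩
    rw [map_mul, Units.val_mul, ← mul_assoc, Matrix.mul_apply_eq_vecMul]
    change Matrix.vecMul (g' i) _ j = 0
    by_cases hid : n - d ≤ i
    · rw [hfix (g' i) fun l hl => hm i hid l ?_]
      · exact hm i hid j hj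
      · rw [Fin.le_def] at hl
        rw [Fin.lt_def]
        simp only at hl
        omega
    · have : i = ⟨n - (d + 1), by omega⟩ := Fin.ext (by simp only; omega)
      rw [this] at hj ⊢
      exact hm' j hj

/-- The Iwasawa decomposition at an infinite place, by the Gram–Schmidt process for the rows, the
last row first. -/
theorem exists_unitary_upperTriangular {𝕜 : Type*} [RCLike 𝕜] (g : Matrix (Fin n) (Fin n) 𝕜) :
    ∃ k ∈ Matrix.unitaryGroup (Fin n) 𝕜, ∀ i j, j < i → (g * k) i j = 0 := by
  have hdim : Module.finrank 𝕜 (EuclideanSpace 𝕜 (Fin n)) = Fintype.card (Fin n)ᵒᵈ := by simp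
  let f : (Fin n)ᵒᵈ → EuclideanSpace 𝕜 (Fin n) := fun i => WithLp.toLp 2 (g (OrderDual.ofDual i))
  let B := InnerProductSpace.gramSchmidtOrthonormalBasis hdim f
  refine ⟨Matrix.of fun l j => star (B (OrderDual.toDual j) l), ?_, fun i j hij => ?_⟩
  · rw [Matrix.mem_unitaryGroup_iff']
    ext i j
    have h := orthonormal_iff_ite.1 B.orthonormal (OrderDual.toDual j) (OrderDual.toDual i)
    rw [PiLp.inner_apply] at h
    simp only [RCLike.inner_apply] at h
    simp only [Matrix.mul_apply, Matrix.star_apply, Matrix.of_apply, star_star, Matrix.one_apply]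
    convert h using 2
    · rfl
    · exact eq_comm
  · have h := InnerProductSpace.gramSchmidtOrthonormalBasis_inv_triangular hdim f
      (show OrderDual.toDual i < OrderDual.toDual j from hij)
    rw [PiLp.inner_apply] at h
    simp only [RCLike.inner_apply] at h
    exact h

end LocalIwasawa

open NumberField IsDedekindDomain

/-! ### The adelic Iwasawa decomposition -/

section GlobalIwasawa

variable {F : Type*} [Field F] {n : ℕ}

theorem exists_unitary_upperTriangular_completion (v : InfinitePlace F)
    (g : Matrix (Fin n) (Fin n) v.Completion) :
    ∃ k : Matrix.GeneralLinearGroup (Fin n) v.Completion,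
      (Matrix.GeneralLinearGroup.map (InfinitePlace.Completion.extensionEmbedding v) k :
        Matrix (Fin n) (Fin n) ℂ) ∈ Matrix.unitaryGroup (Fin n) ℂ ∧
      ∀ i j, j < i → (g * (k : Matrix (Fin n) (Fin n) v.Completion)) i j = 0 := by
  -- It suffices to solve the problem over `ℝ` or `ℂ`, to which the completion is isomorphic.
  have key : ∀ {𝕜 : Type} [RCLike 𝕜] (e : v.Completion ≃+* 𝕜) (ι : 𝕜 →+* ℂ),
      (∀ z, ι (star z) = star (ι z)) →
      (∀ x, ι (e x) = InfinitePlace.Completion.extensionEmbedding v x) →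
      ∃ k : Matrix.GeneralLinearGroup (Fin n) v.Completion,
        (Matrix.GeneralLinearGroup.map (InfinitePlace.Completion.extensionEmbedding v) k :
          Matrix (Fin n) (Fin n) ℂ) ∈ Matrix.unitaryGroup (Fin n) ℂ ∧
        ∀ i j, j < i → (g * (k : Matrix (Fin n) (Fin n) v.Completion)) i j = 0 := by
    intro 𝕜 _ e ι hstar hι
    obtain ⟨k, hk, hup⟩ := exists_unitary_upperTriangular (e.toRingHom.mapMatrix g)
    have h1 := Matrix.mem_unitaryGroup_iff.1 hk
    have h2 := Matrix.mem_unitaryGroup_iff'.1 hk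
    let k' : Matrix.GeneralLinearGroup (Fin n) v.Completion :=
      ⟨e.symm.toRingHom.mapMatrix k, e.symm.toRingHom.mapMatrix (star k),
        by rw [← map_mul, h1, map_one], by rw [← map_mul, h2, map_one]⟩
    have hk' : (Matrix.GeneralLinearGroup.map (InfinitePlace.Completion.extensionEmbedding v) k' :
        Matrix (Fin n) (Fin n) ℂ) = ι.mapMatrix k := by
      ext i j
      change InfinitePlace.Completion.extensionEmbedding v (e.symm (k i j)) = ι (k i j)
      rw [← hι, e.apply_symm_apply]
    refine ⟨k', ?_, fun i j hij => ?_⟩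
    · rw [hk', Matrix.mem_unitaryGroup_iff]
      have : star (ι.mapMatrix k) = ι.mapMatrix (star k) := by
        ext i j
        exact (hstar _).symm
      rw [this, ← map_mul, h1, map_one]
    · apply e.injective
      rw [map_zero, ← hup i j hij]
      have : (e.toRingHom.mapMatrix g * k) = e.toRingHom.mapMatrix
          (g * (k' : Matrix (Fin n) (Fin n) v.Completion)) := by
        rw [map_mul]
        congr 1
        ext i j
        exact (e.apply_symm_apply _).symm
      rw [this]
      rfl
  rcases v.isReal_or_isComplex with hv | hv
  · exact key (InfinitePlace.Completion.ringEquivRealOfIsReal hv) Complex.ofRealHom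
      (fun z => by simp) (fun x => by simp)
  · exact key (InfinitePlace.Completion.ringEquivComplexOfIsComplex hv) (RingHom.id ℂ)
      (fun z => rfl) (fun x => by simp)

variable [NumberField F]

theorem adele_ext {x y : AdeleRing (𝓞 F) F} (h1 : ∀ v, x.1 v = y.1 v)
    (h2 : ∀ v, finiteComponent F v x = finiteComponent F v y) : x = y :=
  Prod.ext (funext h1) (FiniteAdeleRing.ext F h2)

/-- The projection of the adele ring to the completion at an infinite place. -/
def archimedeanComponent (v : InfinitePlace F) : AdeleRing (𝓞 F) F →+* v.Completion where
  toFun x := x.1 v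
  map_one' := rfl
  map_mul' _ _ := rfl
  map_zero' := rfl
  map_add' _ _ := rfl

/-- An adele with given components, integral at all finite places. -/
def integralAdele (x : ∀ v : InfinitePlace F, v.Completion)
    (y : ∀ v : HeightOneSpectrum (𝓞 F), v.adicCompletionIntegers F) : AdeleRing (𝓞 F) F :=
  (x, ⟨fun v => y v, Filter.Eventually.of_forall fun v => (y v).2⟩)

/-- The Iwasawa decomposition over the adeles. Since the local compact factors are integral at all
finite places, they can be chosen independently of each other. -/
theorem exists_iwasawa (g : Matrix.GeneralLinearGroup (Fin n) (AdeleRing (𝓞 F) F)) :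
    ∃ p : Matrix.GeneralLinearGroup (Fin n) (AdeleRing (𝓞 F) F), ∃ k ∈ maxCompact F n,
      (∀ i j, j < i → (p : Matrix (Fin n) (Fin n) (AdeleRing (𝓞 F) F)) i j = 0) ∧ g = p * k := by
  choose kinf hU hup using fun v : InfinitePlace F =>
    exists_unitary_upperTriangular_completion v
      (Matrix.GeneralLinearGroup.map (archimedeanComponent v) g : Matrix (Fin n) (Fin n) _)
  choose m hm using fun v : HeightOneSpectrum (𝓞 F) =>
    exists_integral_upperTriangular (v.adicCompletionIntegers F)
      (Matrix.GeneralLinearGroup.map (finiteComponent F v) g : Matrix (Fin n) (Fin n) _)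
  let mk : (∀ v : InfinitePlace F, Matrix.GeneralLinearGroup (Fin n) v.Completion) →
      (∀ v : HeightOneSpectrum (𝓞 F),
        Matrix.GeneralLinearGroup (Fin n) (v.adicCompletionIntegers F)) →
      Matrix (Fin n) (Fin n) (AdeleRing (𝓞 F) F) := fun x y =>
    Matrix.of fun i j => integralAdele (fun v => (x v : Matrix (Fin n) (Fin n) _) i j)
      fun v => (y v : Matrix (Fin n) (Fin n) _) i j
  have hmk1 : ∀ x y v, (archimedeanComponent v).mapMatrix (mk x y) = x v := fun x y v => rfl
  have hmk2 : ∀ x y v, (finiteComponent F v).mapMatrix (mk x y) = inclGL _ (y v) :=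
    fun x y v => rfl
  have hext : ∀ M N : Matrix (Fin n) (Fin n) (AdeleRing (𝓞 F) F),
      (∀ v, (archimedeanComponent v).mapMatrix M = (archimedeanComponent v).mapMatrix N) →
      (∀ v, (finiteComponent F v).mapMatrix M = (finiteComponent F v).mapMatrix N) → M = N := by
    intro M N h1 h2
    ext i j
    exact adele_ext (fun v => congrFun (congrFun (h1 v) i) j)
      fun v => congrFun (congrFun (h2 v) i) j
  have hinv : ∀ x y x' y', (∀ v, x v * x' v = 1) → (∀ v, y v * y' v = 1) →
      mk x y * mk x' y' = 1 := by
    intro x y x' y' h1 h2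
    refine hext _ _ (fun v => ?_) fun v => ?_
    · rw [map_mul, map_one, hmk1, hmk1, ← Units.val_mul, h1, Units.val_one]
    · rw [map_mul, map_one, hmk2, hmk2, ← Units.val_mul, ← map_mul, h2, map_one, Units.val_one]
  let k : Matrix.GeneralLinearGroup (Fin n) (AdeleRing (𝓞 F) F) :=
    ⟨mk kinf m, mk (fun v => (kinf v)⁻¹) (fun v => (m v)⁻¹),
      hinv _ _ _ _ (fun v => mul_inv_cancel _) (fun v => mul_inv_cancel _),
      hinv _ _ _ _ (fun v => inv_mul_cancel _) (fun v => inv_mul_cancel _)⟩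
  have hk : k ∈ maxCompact F n := ⟨fun v => ⟨m v, Units.ext rfl⟩, fun v => hU v⟩
  refine ⟨g * k, k⁻¹, inv_mem hk, fun i j hij => ?_, by rw [mul_inv_cancel_right]⟩
  refine adele_ext (fun v => ?_) fun v => ?_
  · change (archimedeanComponent v).mapMatrix ((g : Matrix (Fin n) (Fin n) (AdeleRing (𝓞 F) F)) *
      (k : Matrix (Fin n) (Fin n) (AdeleRing (𝓞 F) F)))
      i j = 0
    rw [map_mul]
    exact hup v i j hij
  · change (finiteComponent F v).mapMatrix ((g : Matrix (Fin n) (Fin n) (AdeleRing (𝓞 F) F)) *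
      (k : Matrix (Fin n) (Fin n) (AdeleRing (𝓞 F) F)))
      i j = _
    rw [map_mul, map_zero]
    exact hm v i j hij

end GlobalIwasawa

/-! ### Minors of matrices in the maximal compact subgroup -/

section Minors

variable {F : Type*} [Field F] [NumberField F] {n : ℕ} {ι : Type*} [Fintype ι] [DecidableEq ι]

/-- The minors of a unitary matrix have absolute value at most `1`: a square submatrix is a
contraction, so its eigenvalues lie in the unit disc. -/
theorem norm_det_submatrix_unitary_le_one {U : Matrix (Fin n) (Fin n) ℂ}
    (hU : U ∈ Matrix.unitaryGroup (Fin n) ℂ) (e f : ι ↪ Fin n) :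
    ‖(U.submatrix e f).det‖ ≤ 1 := by
  have hnorm : ∀ x : Fin n → ℂ, ∑ i, ‖(U.mulVec x) i‖ ^ 2 = ∑ i, ‖x i‖ ^ 2 := by
    intro x
    have h : star (U.mulVec x) ⬝ᵥ U.mulVec x = star x ⬝ᵥ x := by
      rw [Matrix.star_mulVec, Matrix.dotProduct_mulVec, Matrix.vecMul_vecMul,
        ← Matrix.star_eq_conjTranspose, Matrix.mem_unitaryGroup_iff'.1 hU, Matrix.vecMul_one]
    have h' : ∀ y : Fin n → ℂ, star y ⬝ᵥ y = ((∑ i, ‖y i‖ ^ 2 : ℝ) : ℂ) := by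
      intro y
      simp only [dotProduct, Pi.star_apply, Complex.ofReal_sum]
      refine Finset.sum_congr rfl fun i _ => ?_
      rw [Complex.ofReal_pow, ← Complex.conj_mul']
      rfl
    rw [h', h'] at h
    exact_mod_cast h
  have hroot : ∀ μ ∈ (U.submatrix e f).charpoly.roots, ‖μ‖ ≤ 1 := by
    intro μ hμ
    have h0 := Polynomial.isRoot_of_mem_roots hμ
    rw [Polynomial.IsRoot, Matrix.eval_charpoly] at h0
    obtain ⟨w, hw, hw0⟩ := Matrix.exists_mulVec_eq_zero_iff.2 h0
    have hSw : ∀ i, (U.submatrix e f).mulVec w i = μ * w i := by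
      intro i
      have := congrFun hw0 i
      rw [Matrix.sub_mulVec, Pi.sub_apply, Matrix.scalar_apply, Matrix.mulVec_diagonal,
        Pi.zero_apply, sub_eq_zero] at this
      exact this.symm
    let x : Fin n → ℂ := Function.extend f w (0 : Fin n → ℂ)
    have hx : ∀ j, x (f j) = w j := fun j => f.injective.extend_apply w _ j
    have hx0 : ∀ i ∉ f '' (Finset.univ : Finset ι), x i = 0 := fun i hi =>
      Function.extend_apply' w _ i fun ⟨j, hj⟩ => hi ⟨j, by simp, hj⟩
    have h1 : ∑ i, ‖x i‖ ^ 2 = ∑ j, ‖w j‖ ^ 2 :=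
      (Finset.sum_of_injOn f f.injective.injOn (fun _ _ => by simp)
        (fun i _ hi => by rw [hx0 i hi, norm_zero]; simp) fun j _ => by rw [hx]).symm
    have h2 : ∀ i, U.mulVec x (e i) = μ * w i := by
      intro i
      rw [← hSw]
      simp only [Matrix.mulVec, dotProduct]
      exact (Finset.sum_of_injOn f f.injective.injOn (fun _ _ => by simp)
        (fun i _ hi => by rw [hx0 i hi, mul_zero]) fun j _ => by
          rw [hx, Matrix.submatrix_apply]).symm
    have h3 : ∑ i, ‖U.mulVec x (e i)‖ ^ 2 ≤ ∑ i, ‖U.mulVec x i‖ ^ 2 := by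
      rw [← Finset.sum_map Finset.univ e fun i => ‖U.mulVec x i‖ ^ 2]
      exact Finset.sum_le_sum_of_subset_of_nonneg (Finset.subset_univ _) fun _ _ _ => by positivity
    simp only [hnorm, h1, h2, norm_mul, mul_pow, ← Finset.mul_sum] at h3
    have hpos : 0 < ∑ j, ‖w j‖ ^ 2 := by
      obtain ⟨j, hj⟩ := Function.ne_iff.1 hw
      exact Finset.sum_pos' (fun _ _ => by positivity)
        ⟨j, Finset.mem_univ _, by have := norm_pos_iff.2 hj; positivity⟩
    have h4 : ‖μ‖ ^ 2 ≤ 1 := le_of_mul_le_mul_right (by rwa [one_mul]) hpos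
    exact (sq_le_one_iff₀ (norm_nonneg _)).1 h4
  rw [Matrix.det_eq_prod_roots_charpoly]
  generalize (U.submatrix e f).charpoly.roots = s at hroot
  induction s using Multiset.induction with
  | empty => simp
  | cons a s ih =>
    rw [Multiset.prod_cons, norm_mul]
    exact mul_le_one₀ (hroot a (Multiset.mem_cons_self a s)) (norm_nonneg _)
      (ih fun μ hμ => hroot μ (Multiset.mem_cons_of_mem hμ))

theorem norm_component_ne_zero (x : (AdeleRing (𝓞 F) F)ˣ) (v : HeightOneSpectrum (𝓞 F)) :
    ‖(x : AdeleRing (𝓞 F) F).2 v‖ ≠ 0 :=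
  norm_ne_zero_iff.2 (x.map (finiteComponent F v).toMonoidHom).ne_zero

theorem ideleNorm_pos (x : (AdeleRing (𝓞 F) F)ˣ) : 0 < ideleNorm x := by
  refine mul_pos (Finset.prod_pos fun v _ => pow_pos (norm_pos_iff.2
    (x.map (archimedeanComponent v).toMonoidHom).ne_zero) _) ?_
  exact finprod_induction (fun r : ℝ => 0 < r) one_pos (fun _ _ => mul_pos)
    fun v => (norm_nonneg _).lt_of_ne (norm_component_ne_zero x v).symm

theorem ideleNorm_le_one {x : (AdeleRing (𝓞 F) F)ˣ}
    (h1 : ∀ v : InfinitePlace F, ‖(x : AdeleRing (𝓞 F) F).1 v‖ ≤ 1)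
    (h2 : ∀ v : HeightOneSpectrum (𝓞 F), ‖(x : AdeleRing (𝓞 F) F).2 v‖ ≤ 1) :
    ideleNorm x ≤ 1 := by
  refine mul_le_one₀ (Finset.prod_le_one (fun v _ => by positivity)
    fun v _ => pow_le_one₀ (norm_nonneg _) (h1 v)) ?_ ?_
  · exact finprod_nonneg fun v => norm_nonneg _
  · exact finprod_induction (fun r : ℝ => r ≤ 1 ∧ 0 ≤ r) ⟨le_rfl, zero_le_one⟩
      (fun a b ha hb => ⟨mul_le_one₀ ha.1 hb.2 hb.1, mul_nonneg ha.2 hb.2⟩)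
      (fun v => ⟨h2 v, norm_nonneg _⟩) |>.1

theorem norm_le_one_of_integral {v : HeightOneSpectrum (𝓞 F)} (x : v.adicCompletionIntegers F) :
    ‖(x : v.adicCompletion F)‖ ≤ 1 := by
  rw [FinitePlace.norm_def]
  have h := (HeightOneSpectrum.mem_adicCompletionIntegers (𝓞 F) F v).1 x.2
  have := (WithZeroMulInt.toNNReal_strictMono
    (HeightOneSpectrum.one_lt_absNorm_nnreal v)).monotone h
  rw [map_one] at this
  exact_mod_cast this

/-- An idele that is a minor of a matrix in `K` has adelic absolute value at most `1`. -/
theorem ideleNorm_minor_le_one {k : Matrix.GeneralLinearGroup (Fin n) (AdeleRing (𝓞 F) F)}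
    (hk : k ∈ maxCompact F n) (e f : ι ↪ Fin n) {x : (AdeleRing (𝓞 F) F)ˣ}
    (hx : (x : AdeleRing (𝓞 F) F)
      = ((k : Matrix (Fin n) (Fin n) (AdeleRing (𝓞 F) F)).submatrix e f).det) :
    ideleNorm x ≤ 1 := by
  refine ideleNorm_le_one (fun v => ?_) fun v => ?_
  · rw [← norm_infiniteComponent, hx, RingHom.map_det]
    exact norm_det_submatrix_unitary_le_one (hk.2 v) e f
  · obtain ⟨m, hm⟩ := hk.1 v
    have h : finiteComponent F v x = (((m : Matrix (Fin n) (Fin n)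
        (v.adicCompletionIntegers F)).submatrix e f).det : v.adicCompletionIntegers F) := by
      rw [hx, RingHom.map_det]
      refine Eq.trans ?_ (RingHom.map_det (v.adicCompletionIntegers F).subtype _).symm
      congr 1
      refine Matrix.ext fun i j => ?_
      exact (congrArg (fun z : Matrix.GeneralLinearGroup (Fin n) (v.adicCompletion F) =>
        (z : Matrix (Fin n) (Fin n) (v.adicCompletion F)) (e i) (f j)) hm).symm
    change ‖finiteComponent F v x‖ ≤ 1
    rw [h]
    exact norm_le_one_of_integral _

end Minors

open scoped Matrix

/-! ### Logarithmic heights -/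

section LogNorm

variable {F : Type*} [Field F] [NumberField F]

/-- The logarithm of the adelic absolute value. -/
def logNorm (x : (AdeleRing (𝓞 F) F)ˣ) : ℝ := Real.log (ideleNorm x)

theorem logNorm_mul (x y : (AdeleRing (𝓞 F) F)ˣ) : logNorm (x * y) = logNorm x + logNorm y := by
  rw [logNorm, ideleNorm_mul, Real.log_mul (ideleNorm_pos x).ne' (ideleNorm_pos y).ne']
  rfl

theorem logNorm_one : logNorm (1 : (AdeleRing (𝓞 F) F)ˣ) = 0 := by
  have := logNorm_mul (1 : (AdeleRing (𝓞 F) F)ˣ) 1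
  rw [mul_one] at this
  linarith

theorem logNorm_prod {ι : Type*} (s : Finset ι) (x : ι → (AdeleRing (𝓞 F) F)ˣ) :
    logNorm (∏ i ∈ s, x i) = ∑ i ∈ s, logNorm (x i) := by
  classical
  induction s using Finset.induction_on with
  | empty => simp [logNorm_one]
  | insert i s hi ih => rw [Finset.prod_insert hi, Finset.sum_insert hi, logNorm_mul, ih]

end LogNorm

/-! ### Heights of families of vectors -/

section Heights

variable {F : Type*} [Field F] [NumberField F] {n : ℕ}

/-- `r` is the logarithmic height, with respect to `g`, of the family of row vectors `w`: one has
`w g = D k'`, where the rows of `k'` are rows of a matrix in `K`, and `r = log |det D|`. This is the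
logarithm of the norm of the exterior product of the vectors `w i * g`, expressed without exterior
powers. -/
def IsLogHeight (g : Matrix.GeneralLinearGroup (Fin n) (AdeleRing (𝓞 F) F)) {ι : Type*} [Fintype ι]
    [DecidableEq ι] (w : ι → Fin n → F) (r : ℝ) : Prop :=
  ∃ (D : Matrix ι ι (AdeleRing (𝓞 F) F)) (d : (AdeleRing (𝓞 F) F)ˣ),
    ∃ k ∈ maxCompact F n, ∃ e : ι ↪ Fin n,
      (Matrix.of w).map (algebraMap F (AdeleRing (𝓞 F) F)) *
          (g : Matrix (Fin n) (Fin n) (AdeleRing (𝓞 F) F))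
        = D * (k : Matrix (Fin n) (Fin n) (AdeleRing (𝓞 F) F)).submatrix e id ∧
      D.det = d ∧ r = logNorm d

variable {g : Matrix.GeneralLinearGroup (Fin n) (AdeleRing (𝓞 F) F)} {ι : Type*} [Fintype ι]
  [DecidableEq ι] {w : ι → Fin n → F} {r : ℝ}

/-- The height dominates the maximal minors of `w g k₀`, for every `k₀` in `K`. -/
theorem IsLogHeight.logNorm_le (h : IsLogHeight g w r)
    {k₀ : Matrix.GeneralLinearGroup (Fin n) (AdeleRing (𝓞 F) F)} (hk₀ : k₀ ∈ maxCompact F n)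
    (f : ι ↪ Fin n) {b : (AdeleRing (𝓞 F) F)ˣ}
    (hb : (((Matrix.of w).map (algebraMap F (AdeleRing (𝓞 F) F)) *
      (g : Matrix (Fin n) (Fin n) (AdeleRing (𝓞 F) F)) *
      (k₀ : Matrix (Fin n) (Fin n) (AdeleRing (𝓞 F) F))).submatrix id f).det = b) :
    logNorm b ≤ r := by
  obtain ⟨D, d, k, hk, e, hM, hD, rfl⟩ := h
  have h1 : (D * (k : Matrix (Fin n) (Fin n) (AdeleRing (𝓞 F) F)).submatrix e id *
      (k₀ : Matrix (Fin n) (Fin n) (AdeleRing (𝓞 F) F))).submatrix id f =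
      D * ((k * k₀ : Matrix.GeneralLinearGroup (Fin n) (AdeleRing (𝓞 F) F)) :
        Matrix (Fin n) (Fin n) (AdeleRing (𝓞 F) F)).submatrix e f := by
    rw [Matrix.mul_assoc]
    rfl
  rw [hM, h1, Matrix.det_mul, hD] at hb
  have h2 : ideleNorm (d⁻¹ * b) ≤ 1 := by
    refine ideleNorm_minor_le_one (mul_mem hk hk₀) e f ?_
    rw [Units.val_mul, ← hb, Units.inv_mul_cancel_left]
  have h3 : logNorm b = logNorm d + logNorm (d⁻¹ * b) := by
    rw [← logNorm_mul, mul_inv_cancel_left]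
  have h4 : logNorm (d⁻¹ * b) ≤ 0 := Real.log_nonpos (ideleNorm_pos _).le h2
  linarith

theorem IsLogHeight.le (h : IsLogHeight g w r) {r' : ℝ} (h' : IsLogHeight g w r') : r' ≤ r := by
  obtain ⟨D, d, k, hk, e, hM, hD, rfl⟩ := h'
  refine h.logNorm_le (inv_mem hk) e ?_
  rw [hM, ← hD, Matrix.mul_assoc]
  congr 1
  have h1 : (k : Matrix (Fin n) (Fin n) (AdeleRing (𝓞 F) F)).submatrix e id *
      ((k⁻¹ : Matrix.GeneralLinearGroup (Fin n) (AdeleRing (𝓞 F) F)) :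
        Matrix (Fin n) (Fin n) (AdeleRing (𝓞 F) F)) =
      (1 : Matrix (Fin n) (Fin n) (AdeleRing (𝓞 F) F)).submatrix e id := by
    rw [← Units.val_one, ← mul_inv_cancel k]
    rfl
  rw [h1]
  have h2 : (D * (1 : Matrix (Fin n) (Fin n) (AdeleRing (𝓞 F) F)).submatrix e id).submatrix id e =
      D * (1 : Matrix (Fin n) (Fin n) (AdeleRing (𝓞 F) F)).submatrix e e := rfl
  rw [h2, Matrix.submatrix_one e e.injective, mul_one]

theorem IsLogHeight.unique (h : IsLogHeight g w r) {r' : ℝ} (h' : IsLogHeight g w r') : r = r' :=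
  le_antisymm (h'.le h) (h.le h')

theorem IsLogHeight.reindex (h : IsLogHeight g w r) {κ : Type*} [Fintype κ] [DecidableEq κ]
    (σ : κ ≃ ι) : IsLogHeight g (w ∘ σ) r := by
  obtain ⟨D, d, k, hk, e, hM, hD, rfl⟩ := h
  refine ⟨D.submatrix σ σ, d, k, hk, σ.toEmbedding.trans e, ?_,
    by rw [Matrix.det_submatrix_equiv_self, hD], rfl⟩
  have h1 : D.submatrix σ σ * (k : Matrix (Fin n) (Fin n) (AdeleRing (𝓞 F) F)).submatrix
      (σ.toEmbedding.trans e) id = (D * (k : Matrix (Fin n) (Fin n)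
        (AdeleRing (𝓞 F) F)).submatrix e id).submatrix σ id := by
    rw [Matrix.submatrix_mul _ _ σ σ id σ.bijective]
    rfl
  rw [h1, ← hM]
  rfl

/-- By the product formula, the height does not change under an invertible linear substitution with
coefficients in `F`. -/
theorem IsLogHeight.transform (h : IsLogHeight g w r) (T : Matrix ι ι F) (hT : IsUnit T.det) :
    IsLogHeight g (fun i => ∑ j, T i j • w j) r := by
  obtain ⟨D, d, k, hk, e, hM, hD, rfl⟩ := h
  obtain ⟨t, ht⟩ := hT
  refine ⟨T.map (algebraMap F (AdeleRing (𝓞 F) F)) * D,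
    Units.map (algebraMap F (AdeleRing (𝓞 F) F)).toMonoidHom t * d, k, hk, e, ?_, ?_, ?_⟩
  · have h1 : Matrix.of (fun i => ∑ j, T i j • w j) = T * Matrix.of w := by
      ext i l
      simp [Matrix.mul_apply, Finset.sum_apply]
    rw [h1, Matrix.map_mul, Matrix.mul_assoc, hM, Matrix.mul_assoc]
  · rw [Matrix.det_mul, hD, Units.val_mul]
    congr 1
    rw [← RingHom.mapMatrix_apply, ← RingHom.map_det, ← ht]
    rfl
  · rw [logNorm_mul, logNorm, logNorm, ideleNorm_principal, Real.log_one, zero_add]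

/-- Two bases of the same subspace have the same height. -/
theorem IsLogHeight.of_span_eq (h : IsLogHeight g w r) (hw : LinearIndependent F w) {κ : Type*}
    [Fintype κ] [DecidableEq κ] {u : κ → Fin n → F} (hu : LinearIndependent F u)
    (hspan : Submodule.span F (Set.range u) = Submodule.span F (Set.range w)) :
    IsLogHeight g u r := by
  let B : Basis ι F (Submodule.span F (Set.range w)) := Basis.span hw
  let C : Basis κ F (Submodule.span F (Set.range w)) :=
    (Basis.span hu).map (LinearEquiv.ofEq _ _ hspan)
  have hB : ∀ i, (B i : Fin n → F) = w i := fun i => by simp [B, Basis.span_apply]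
  have hC : ∀ i, (C i : Fin n → F) = u i := fun i => by simp [C, Basis.span_apply]
  let σ : κ ≃ ι := C.indexEquiv B
  let B' := B.reindex σ.symm
  have hB' : ∀ i, (B' i : Fin n → F) = w (σ i) := fun i => by simp [B', hB]
  have hT : IsUnit (B'.toMatrix C)ᵀ.det := by
    rw [Matrix.det_transpose, ← Basis.det_apply]
    exact B'.isUnit_det C
  have h1 := (h.reindex σ).transform _ hT
  convert h1 using 1
  ext1 i
  have h2 := congrArg (Subtype.val) (B'.sum_toMatrix_smul_self C i)
  rw [hC, AddSubmonoidClass.coe_finsetSum] at h2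
  rw [← h2]
  refine Finset.sum_congr rfl fun j _ => ?_
  rw [Submodule.coe_smul, hB']
  rfl

end Heights

/-! ### Heights of subspaces -/

section FlagHeights

variable {F : Type*} [Field F] [NumberField F] {n : ℕ}

theorem lt_of_index_lt (c : Composition n) {i j : Fin n} (h : c.index i < c.index j) : i < j := by
  by_contra! hle
  have h1 := c.sizeUpTo_index_le i
  have h2 := c.lt_sizeUpTo_index_succ i
  have h3 := c.sizeUpTo_index_le j
  have h4 := c.monotone_sizeUpTo (show (c.index i : ℕ).succ ≤ c.index j from h)
  rw [Fin.le_def] at hle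
  simp only [Fin.val_succ, Nat.succ_eq_add_one] at h2 h4
  omega

/-- The Iwasawa decomposition of `δ g` with respect to the Borel subgroup computes all
Harish-Chandra maps and the heights of the spans of the last rows of `δ`: the `q i` are the
logarithms of the absolute values of the diagonal entries. -/
theorem exists_diagonal_exponents (g : Matrix.GeneralLinearGroup (Fin n) (AdeleRing (𝓞 F) F))
    (δ : Matrix.GeneralLinearGroup (Fin n) F) :
    ∃ q : Fin n → ℝ,
      (∀ (c : Composition n) (b : Fin c.length),
        harishChandra c (diag δ * g) b = ∑ i : {i : Fin n // c.index i = b}, q i) ∧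
      (∀ (P : Fin n → Prop) [DecidablePred P], (∀ i j, i ≤ j → P i → P j) →
        IsLogHeight g (fun i : {i // P i} => (δ : Matrix (Fin n) (Fin n) F) i)
          (∑ i : {i // P i}, q i)) ∧
      ∀ (P : Fin n → Prop) [DecidablePred P] (r : ℝ),
        IsLogHeight g (fun i : {i // P i} => (δ : Matrix (Fin n) (Fin n) F) i) r →
          ∑ i : {i // P i}, q i ≤ r := by
  obtain ⟨p, k, hk, hup, heq⟩ := exists_iwasawa (diag δ * g)
  set A := AdeleRing (𝓞 F) F
  have hunit : ∀ i, IsUnit ((p : Matrix (Fin n) (Fin n) A) i i) := by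
    intro i
    have h1 : IsUnit (p : Matrix (Fin n) (Fin n) A).det :=
      (Matrix.isUnit_iff_isUnit_det _).1 p.isUnit
    rw [Matrix.det_of_isUpperTriangular fun i j hij => hup i j hij] at h1
    exact isUnit_of_dvd_unit (Finset.dvd_prod_of_mem
      (fun i => (p : Matrix (Fin n) (Fin n) A) i i) (Finset.mem_univ i)) h1
  choose u hu using hunit
  have hdet : ∀ (P : Fin n → Prop) [DecidablePred P],
      ((p : Matrix (Fin n) (Fin n) A).submatrix (Subtype.val : {i // P i} → Fin n)
        Subtype.val).det = ((∏ i : {i // P i}, u i : Aˣ) : A) := by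
    intro P _
    have h : ((p : Matrix (Fin n) (Fin n) A).submatrix (Subtype.val : {i // P i} → Fin n)
        Subtype.val).IsUpperTriangular := fun i j hij => hup i j hij
    rw [Matrix.det_of_isUpperTriangular h, Units.coe_prod]
    exact Finset.prod_congr rfl fun i _ => (hu i).symm
  have hrows : ∀ (P : Fin n → Prop) [DecidablePred P],
      (Matrix.of fun i : {i // P i} => (δ : Matrix (Fin n) (Fin n) F) i).map (algebraMap F A) *
        (g : Matrix (Fin n) (Fin n) A) = ((p * k : Matrix.GeneralLinearGroup (Fin n) A) :
          Matrix (Fin n) (Fin n) A).submatrix (Subtype.val : {i // P i} → Fin n) id := by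
    intro P _
    rw [← heq]
    rfl
  refine ⟨fun i => logNorm (u i), fun c b => ?_, fun P _ hP => ?_, fun P _ r hr => ?_⟩
  · have hpar : p ∈ parabolic c A := fun i j hij => hup i j (lt_of_index_lt c hij)
    rw [heq, harishChandra_eq c ⟨p, hpar⟩ hk b, ← logNorm_prod]
    change logNorm _ = _
    congr 1
    ext1
    rw [coe_blockDet]
    exact hdet _
  · refine ⟨_, _, k, hk, Function.Embedding.subtype P, ?_, hdet P, (logNorm_prod _ _).symm⟩
    rw [hrows P, Units.val_mul]
    ext i j
    simp only [Matrix.submatrix_apply, Matrix.mul_apply, id]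
    symm
    refine Finset.sum_of_injOn Subtype.val Subtype.val_injective.injOn (fun _ _ => by simp)
      (fun l _ hl => ?_) fun l _ => rfl
    have hl' : ¬ P l := fun h => hl ⟨⟨l, h⟩, by simp, rfl⟩
    rw [hup i l (lt_of_not_ge fun h => hl' (hP i l h i.2)), zero_mul]
  · rw [← logNorm_prod]
    refine hr.logNorm_le (inv_mem hk) (Function.Embedding.subtype P) ?_
    rw [hrows P, ← hdet P]
    have : ((p * k : Matrix.GeneralLinearGroup (Fin n) A) : Matrix (Fin n) (Fin n) A).submatrix
        (Subtype.val : {i // P i} → Fin n) id * ((k⁻¹ : Matrix.GeneralLinearGroup (Fin n) A) :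
          Matrix (Fin n) (Fin n) A) =
        ((p * k * k⁻¹ : Matrix.GeneralLinearGroup (Fin n) A) : Matrix (Fin n) (Fin n) A).submatrix
          (Subtype.val : {i // P i} → Fin n) id := rfl
    rw [this, mul_inv_cancel_right]
    rfl

theorem exists_isLogHeight (g : Matrix.GeneralLinearGroup (Fin n) (AdeleRing (𝓞 F) F))
    (W : Submodule F (Fin n → F)) :
    ∃ r : ℝ, ∀ (P : Fin n → Prop) [DecidablePred P] (w : {i // P i} → Fin n → F),
      LinearIndependent F w → Submodule.span F (Set.range w) = W → IsLogHeight g w r := by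
  classical
  obtain ⟨b, hb, hspan, -, -, hW, -, -⟩ := exists_adapted_of_pair ⊥ W
  obtain ⟨δ, hδ, hmono⟩ := exists_GL_rows hb hspan fun v => if v ∈ W then 1 else 0
  obtain ⟨q, -, hq, -⟩ := exists_diagonal_exponents g δ
  have h1 := hq (fun i => (δ : Matrix (Fin n) (Fin n) F) i ∈ W) (by
    intro i j hij hi
    by_contra hj
    have := hmono hij
    simp [hi, hj] at this)
  refine ⟨_, fun P _ w hw hwW => h1.of_span_eq
    (LinearIndependent.comp (GL_rows_linearIndependent δ) Subtype.val Subtype.val_injective) hw ?_⟩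
  rw [hwW, span_rows_eq δ hδ hW fun i => Iff.rfl]

/-- The logarithmic height, with respect to `g`, of a subspace of `Fⁿ`. -/
def logHeight (g : Matrix.GeneralLinearGroup (Fin n) (AdeleRing (𝓞 F) F))
    (W : Submodule F (Fin n → F)) : ℝ := (exists_isLogHeight g W).choose

theorem isLogHeight_rows (g : Matrix.GeneralLinearGroup (Fin n) (AdeleRing (𝓞 F) F))
    (δ : Matrix.GeneralLinearGroup (Fin n) F) (P : Fin n → Prop) [DecidablePred P]
    {W : Submodule F (Fin n → F)} (hW : Submodule.span F (Set.range fun i : {i : Fin n // P i} =>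
      (δ : Matrix (Fin n) (Fin n) F) i) = W) :
    IsLogHeight g (fun i : {i // P i} => (δ : Matrix (Fin n) (Fin n) F) i) (logHeight g W) :=
  (exists_isLogHeight g W).choose_spec P _
    (LinearIndependent.comp (GL_rows_linearIndependent δ) Subtype.val Subtype.val_injective) hW

theorem exists_exponents_tailSpan (g : Matrix.GeneralLinearGroup (Fin n) (AdeleRing (𝓞 F) F))
    (δ : Matrix.GeneralLinearGroup (Fin n) F) :
    ∃ q : Fin n → ℝ,
      (∀ (c : Composition n) (b : Fin c.length),
        harishChandra c (diag δ * g) b = ∑ i with c.index i = b, q i) ∧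
      ∀ a : ℕ, logHeight g (tailSpan δ a) = ∑ i : Fin n with a ≤ i.val, q i := by
  obtain ⟨q, h1, h2, -⟩ := exists_diagonal_exponents g δ
  refine ⟨q, fun c b => ?_, fun a => ?_⟩
  · rw [h1]
    exact (Finset.sum_subtype _ (by simp) q).symm
  · rw [(isLogHeight_rows g δ (fun i => a ≤ i.val) (W := tailSpan δ a) rfl).unique
      (h2 _ fun i j hij hi => hi.trans hij)]
    exact (Finset.sum_subtype _ (by simp) q).symm

theorem logHeight_bot (g : Matrix.GeneralLinearGroup (Fin n) (AdeleRing (𝓞 F) F)) :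
    logHeight g ⊥ = 0 := by
  obtain ⟨q, -, hq⟩ := exists_exponents_tailSpan g 1
  have h := hq n
  have h0 : tailSpan (1 : Matrix.GeneralLinearGroup (Fin n) F) n = ⊥ :=
    Submodule.finrank_eq_zero.1 (by rw [finrank_tailSpan, Nat.sub_self])
  rw [h0, Finset.filter_false_of_mem fun i _ => not_le_of_gt i.2] at h
  simpa using h

theorem imp_of_weight_le {a b c a' b' c' : Prop} [Decidable a] [Decidable b] [Decidable c]
    [Decidable a'] [Decidable b'] [Decidable c'] (hab : a → b) (hbc : b → c) (hab' : a' → b')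
    (hbc' : b' → c') (h : (if a then 1 else 0) + (if b then 1 else 0) + (if c then 1 else 0) ≤
      (if a' then 1 else 0) + (if b' then 1 else 0) + (if c' then 1 else 0)) :
    (a → a') ∧ (b → b') ∧ (c → c') := by
  by_cases a <;> by_cases b <;> by_cases c <;> by_cases a' <;> by_cases b' <;> by_cases c' <;>
    simp_all

/-- The submodularity of the height. In a basis adapted to `X` and `Y`, ordered such that
`X ⊓ Y`, `Y` and `X ⊔ Y` are spanned by its last members, three of the heights are products of
diagonal entries of the Iwasawa decomposition, and the height of `X` is at least such a product. -/
theorem logHeight_submodular (g : Matrix.GeneralLinearGroup (Fin n) (AdeleRing (𝓞 F) F))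
    (X Y : Submodule F (Fin n → F)) :
    logHeight g (X ⊔ Y) + logHeight g (X ⊓ Y) ≤ logHeight g X + logHeight g Y := by
  classical
  obtain ⟨b, hb, hspan, hI, hX, hY, hS, hXY⟩ := exists_adapted_of_pair X Y
  obtain ⟨δ, hδ, hmono⟩ := exists_GL_rows hb hspan fun v =>
    (if v ∈ X ⊓ Y then 1 else 0) + (if v ∈ Y then 1 else 0) + (if v ∈ X ⊔ Y then 1 else 0)
  obtain ⟨q, -, hq, hq'⟩ := exists_diagonal_exponents g δ
  set row : Fin n → Fin n → F := fun i => (δ : Matrix (Fin n) (Fin n) F) i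
  have hIY : ∀ v, v ∈ X ⊓ Y → v ∈ Y := fun v h => (Submodule.mem_inf.1 h).2
  have hYS : ∀ v, v ∈ Y → v ∈ X ⊔ Y := fun v h => Submodule.mem_sup_right h
  have hup : ∀ i j, i ≤ j → (row i ∈ X ⊓ Y → row j ∈ X ⊓ Y) ∧ (row i ∈ Y → row j ∈ Y) ∧
      (row i ∈ X ⊔ Y → row j ∈ X ⊔ Y) := fun i j hij =>
    imp_of_weight_le (hIY _) (hYS _) (hIY _) (hYS _) (hmono hij)
  have hval : ∀ W : Submodule F (Fin n → F), (∀ i j, i ≤ j → row i ∈ W → row j ∈ W) →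
      Submodule.span F (b ∩ W) = W → logHeight g W = ∑ i with row i ∈ W, q i := by
    intro W hW hbW
    rw [(isLogHeight_rows g δ (fun i => row i ∈ W) (span_rows_eq δ hδ hbW fun i => Iff.rfl)).unique
      (hq _ hW)]
    exact (Finset.sum_subtype _ (by simp) q).symm
  have hXle : ∑ i with row i ∈ X, q i ≤ logHeight g X := by
    refine le_of_eq_of_le ?_ (hq' (fun i => row i ∈ X) _ (isLogHeight_rows g δ
      (fun i => row i ∈ X) (span_rows_eq δ hδ hX fun i => Iff.rfl)))
    exact Finset.sum_subtype _ (by simp) q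
  rw [hval _ (fun i j h => (hup i j h).1) hI, hval Y (fun i j h => (hup i j h).2.1) hY,
    hval _ (fun i j h => (hup i j h).2.2) hS]
  refine le_trans (le_of_eq ?_) (add_le_add_left hXle _)
  simp only [Finset.sum_filter, ← Finset.sum_add_distrib]
  refine Finset.sum_congr rfl fun i _ => ?_
  -- A member of the adapted basis that lies in `X ⊔ Y` lies in `X` or in `Y`.
  have hS' : row i ∈ X ⊔ Y ↔ row i ∈ X ∨ row i ∈ Y :=
    ⟨hXY (row i) (hδ ▸ ⟨i, rfl⟩), fun h => h.elim Submodule.mem_sup_left Submodule.mem_sup_right⟩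
  simp only [hS', Submodule.mem_inf]
  by_cases hx : row i ∈ X <;> by_cases hy : row i ∈ Y <;> simp [hx, hy]

end FlagHeights

/-! ### Compositions and polygons -/

section Boundaries

variable {n : ℕ}

/-- `a` is a partial sum of the parts of `c`, that is, a place where a block begins, or the end. -/
def IsBoundary (c : Composition n) (a : ℕ) : Prop := ∃ b ≤ c.length, c.sizeUpTo b = a

theorem IsBoundary.le {c : Composition n} {a : ℕ} (h : IsBoundary c a) : a ≤ n := by
  obtain ⟨b, -, rfl⟩ := h
  exact c.sizeUpTo_le b

theorem isBoundary_zero (c : Composition n) : IsBoundary c 0 :=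
  ⟨0, Nat.zero_le _, c.sizeUpTo_zero⟩

theorem isBoundary_last (c : Composition n) : IsBoundary c n := ⟨_, le_rfl, c.sizeUpTo_length⟩

theorem index_lt_iff (c : Composition n) (i : Fin n) (b : ℕ) :
    (c.index i : ℕ) < b ↔ (i : ℕ) < c.sizeUpTo b := by
  constructor
  · intro h
    exact (c.lt_sizeUpTo_index_succ i).trans_le (c.monotone_sizeUpTo h)
  · intro h
    by_contra! hle
    exact absurd ((c.monotone_sizeUpTo hle).trans (c.sizeUpTo_index_le i)) (not_le_of_gt h)

theorem isBoundary_iff_mem (c : Composition n) (a : Fin (n + 1)) :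
    IsBoundary c a ↔ a ∈ c.boundaries := by
  simp only [Composition.boundaries, Finset.mem_map, Finset.mem_univ, true_and]
  constructor
  · rintro ⟨b, hb, h⟩
    exact ⟨⟨b, Nat.lt_succ_of_le hb⟩, Fin.ext h⟩
  · rintro ⟨b, h⟩
    exact ⟨b, Nat.le_of_lt_succ b.2, congrArg Fin.val h⟩

theorem composition_eq_of_isBoundary {c c' : Composition n}
    (h : ∀ a, IsBoundary c a ↔ IsBoundary c' a) : c = c' := by
  apply (compositionEquiv n).injective
  apply CompositionAsSet.ext
  change c.boundaries = c'.boundaries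
  ext a
  rw [← isBoundary_iff_mem, ← isBoundary_iff_mem, h]

theorem exists_composition (s : Set ℕ) (h0 : 0 ∈ s) (hn : n ∈ s) (hs : ∀ a ∈ s, a ≤ n) :
    ∃ c : Composition n, ∀ a, IsBoundary c a ↔ a ∈ s := by
  classical
  let C : CompositionAsSet n := ⟨Finset.univ.filter fun a : Fin (n + 1) => (a : ℕ) ∈ s,
    by simpa using h0, by simpa using hn⟩
  refine ⟨C.toComposition, fun a => ?_⟩
  constructor
  · intro h
    have := (isBoundary_iff_mem C.toComposition ⟨a, Nat.lt_succ_of_le h.le⟩).1 h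
    rw [C.toComposition_boundaries] at this
    simpa [C] using this
  · intro h
    refine (isBoundary_iff_mem C.toComposition ⟨a, Nat.lt_succ_of_le (hs a h)⟩).2 ?_
    rw [C.toComposition_boundaries]
    simpa [C] using h

/-- The sum of the entries of index at least `j`. -/
def tailSum (s : Fin n → ℝ) (j : ℕ) : ℝ := ∑ i : Fin n with j ≤ i.val, s i

theorem tailSum_eq_add (s : Fin n → ℝ) {j : ℕ} (hj : j < n) :
    tailSum s j = s ⟨j, hj⟩ + tailSum s (j + 1) := by
  unfold tailSum
  rw [← Finset.sum_insert (by simp)]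
  congr 1
  ext i
  simp only [Finset.mem_filter, Finset.mem_univ, true_and, Finset.mem_insert, Fin.ext_iff]
  omega

theorem tailSum_eq_add_mul (s : Fin n → ℝ) {a : ℕ} {σ : ℝ} (d : ℕ) (hd : a + d ≤ n)
    (hs : ∀ i : Fin n, a ≤ i → (i : ℕ) < a + d → s i = σ) :
    tailSum s a = tailSum s (a + d) + d * σ := by
  induction d with
  | zero => simp
  | succ d ih =>
    rw [ih (by omega) fun i h1 h2 => hs i h1 (by omega),
      tailSum_eq_add s (show a + d < n by omega), hs ⟨a + d, by omega⟩ (by simp) (by simp)]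
    push_cast
    rw [add_assoc a d 1]
    ring

theorem isBoundary_of_index_lt (c : Composition n) {i k : Fin n} (hk : (k : ℕ) = i + 1)
    (h : c.index i < c.index k) : IsBoundary c k := by
  refine ⟨c.index k, (c.index k).2.le, le_antisymm (c.sizeUpTo_index_le k) ?_⟩
  have := (index_lt_iff c i (c.index k)).1 h
  omega

/-- The tail sums of a sequence that is constant on the blocks of `c` interpolate linearly between
the boundaries of `c`. -/
theorem tailSum_interpolate (c : Composition n) {s : Fin n → ℝ}
    (hs : ∀ i j, c.index i = c.index j → s i = s j) {j : ℕ} (hj : j ≤ n) (hb : ¬ IsBoundary c j) :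
    ∃ a a', IsBoundary c a ∧ IsBoundary c a' ∧ a < j ∧ j < a' ∧
      (∀ l, IsBoundary c l → a < l → l < a' → False) ∧
      ((a' : ℝ) - a) * tailSum s j = (a' - j) * tailSum s a + (j - a) * tailSum s a' := by
  have hjn : j < n := lt_of_le_of_ne hj fun h => hb (h ▸ isBoundary_last c)
  set b := c.index ⟨j, hjn⟩
  have h1 : c.sizeUpTo b ≤ j := c.sizeUpTo_index_le ⟨j, hjn⟩
  have h2 : j < c.sizeUpTo (b + 1) := c.lt_sizeUpTo_index_succ ⟨j, hjn⟩
  have hB1 : IsBoundary c (c.sizeUpTo b) := ⟨b, b.2.le, rfl⟩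
  have hB2 : IsBoundary c (c.sizeUpTo (b + 1)) := ⟨b + 1, b.2, rfl⟩
  have h1' : c.sizeUpTo b < j := lt_of_le_of_ne h1 fun h => hb (h ▸ hB1)
  have hconst : ∀ i : Fin n, c.sizeUpTo b ≤ i → (i : ℕ) < c.sizeUpTo (b + 1) →
      s i = s ⟨j, hjn⟩ := by
    intro i hi1 hi2
    refine hs _ _ (Fin.ext ?_)
    have h3 := (index_lt_iff c i (b + 1)).2 hi2
    have h4 := mt (index_lt_iff c i b).1 (not_lt_of_ge hi1)
    change (c.index i : ℕ) = b
    omega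
  have hn2 := hB2.le
  refine ⟨_, _, hB1, hB2, h1', h2, ?_, ?_⟩
  · rintro l ⟨b', -, rfl⟩ hl1 hl2
    have h3 : (b : ℕ) < b' := c.monotone_sizeUpTo.reflect_lt hl1
    have h4 : b' < (b : ℕ) + 1 := c.monotone_sizeUpTo.reflect_lt hl2
    omega
  · obtain ⟨d, hd⟩ := Nat.exists_eq_add_of_lt h1'
    obtain ⟨d', hd'⟩ := Nat.exists_eq_add_of_lt h2
    have e1 := tailSum_eq_add_mul s (a := c.sizeUpTo b) (σ := s ⟨j, hjn⟩) (d + 1) (by omega)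
      fun i hi1 hi2 => hconst i hi1 (by omega)
    have e2 := tailSum_eq_add_mul s (a := j) (σ := s ⟨j, hjn⟩) (d' + 1) (by omega)
      fun i hi1 hi2 => hconst i (by omega) (by omega)
    rw [← add_assoc, ← hd] at e1
    rw [← add_assoc, ← hd'] at e2
    have c1 : (j : ℝ) = c.sizeUpTo b + d + 1 := by exact_mod_cast hd
    have c2 : (c.sizeUpTo (b + 1) : ℝ) = j + d' + 1 := by exact_mod_cast hd'
    rw [e1, e2, c2, c1]
    push_cast
    ring

/-- On sequences that are constant on the blocks of `c`, the functional `ρ_P` is the area under the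
chord of the polygon of tail sums minus the area under this polygon, by the trapezoidal rule. The
term `j = n - 1` of the sum is zero. -/
theorem sum_rho_mul (c : Composition n) {s : Fin n → ℝ}
    (hs : ∀ i j, c.index i = c.index j → s i = s j) :
    ∑ i, rho c i * s i = (n - 1) / 2 * tailSum s 0 - ∑ j ∈ Finset.range n, tailSum s (j + 1) := by
  have h1 : ∑ i, rho c i * s i = 1 / 2 * ∑ k, ∑ l, if k < l then s k - s l else 0 := by
    have h2 : ∀ i, rho c i * s i = 1 / 2 * ∑ k, ∑ l, (if c.index k < c.index l then
        (Pi.single k 1 - Pi.single l 1 : Fin n → ℝ) i * s i else 0) := by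
      intro i
      simp only [rho, Pi.smul_apply, smul_eq_mul, Finset.sum_apply, mul_assoc, Finset.sum_mul]
      refine congrArg _ (Finset.sum_congr rfl fun k _ => Finset.sum_congr rfl fun l _ => ?_)
      split_ifs <;> simp
    simp only [h2, ← Finset.mul_sum]
    rw [Finset.sum_comm]
    refine congrArg _ (Finset.sum_congr rfl fun k _ => ?_)
    rw [Finset.sum_comm]
    refine Finset.sum_congr rfl fun l _ => ?_
    by_cases hkl : c.index k < c.index l
    · simp [hkl, lt_of_index_lt c hkl, sub_mul, Finset.sum_sub_distrib, Pi.single_apply]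
    · simp only [if_neg hkl, Finset.sum_const_zero]
      by_cases h : k < l
      · rw [if_pos h, hs k l, sub_self]
        refine le_antisymm ?_ (not_lt.1 hkl)
        exact not_lt.1 fun h' => lt_asymm h (lt_of_index_lt c h')
      · rw [if_neg h]
  have h3 : ∀ k : Fin n, (∑ l : Fin n, if k < l then s k else 0) = (n - 1 - k) * s k := by
    intro k
    rw [← Finset.sum_filter, Finset.sum_const, nsmul_eq_mul]
    congr 1
    have : Finset.univ.filter (fun l => k < l) = Finset.Ioi k := by ext; simp
    rw [this, Fin.card_Ioi, Nat.cast_sub (show (k : ℕ) ≤ n - 1 by omega),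
      Nat.cast_sub (show 1 ≤ n from k.pos), Nat.cast_one]
  have h4 : ∀ l : Fin n, (∑ k : Fin n, if k < l then s l else 0) = l * s l := by
    intro l
    rw [← Finset.sum_filter, Finset.sum_const, nsmul_eq_mul]
    congr 1
    have : Finset.univ.filter (fun k => k < l) = Finset.Iio l := by ext; simp
    rw [this, Fin.card_Iio]
  have h5 : ∑ j ∈ Finset.range n, tailSum s (j + 1) = ∑ l : Fin n, (l : ℝ) * s l := by
    rw [Finset.sum_range (fun j => tailSum s (j + 1))]
    simp only [tailSum, Finset.sum_filter, Nat.succ_le_iff]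
    rw [Finset.sum_comm]
    exact Finset.sum_congr rfl fun l _ => h4 l
  have h6 : (∑ k : Fin n, ∑ l : Fin n, if k < l then s k - s l else 0)
      = ∑ k : Fin n, (n - 1 - k) * s k - ∑ l : Fin n, (l : ℝ) * s l := by
    simp only [← h3, ← h4]
    rw [Finset.sum_comm (f := fun (l : Fin n) (k : Fin n) => if k < l then s l else 0)]
    simp only [← Finset.sum_sub_distrib]
    refine Finset.sum_congr rfl fun k _ => Finset.sum_congr rfl fun l _ => ?_
    split_ifs <;> simp
  have h7 : tailSum s 0 = ∑ i, s i := by simp [tailSum]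
  rw [h1, h6, h5, h7, Finset.mul_sum, mul_sub, Finset.mul_sum, Finset.mul_sum,
    ← Finset.sum_sub_distrib, ← Finset.sum_sub_distrib]
  exact Finset.sum_congr rfl fun i _ => by ring

end Boundaries

/-! ### Parabolic subgroups and flags -/

section Parabolics

variable {n : ℕ} {F : Type*} [Field F]

theorem parabolic_le_of_isBoundary {c c' : Composition n}
    (h : ∀ a, IsBoundary c' a → IsBoundary c a) : parabolic c F ≤ parabolic c' F := by
  intro γ hγ i j hij
  obtain ⟨b, -, hb⟩ := h _ ⟨c'.index i, (c'.index i).2.le, rfl⟩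
  refine hγ (Fin.lt_def.2 ?_)
  have h1 : (j : ℕ) < c.sizeUpTo b := hb ▸ (index_lt_iff c' j _).1 hij
  have h2 : c.sizeUpTo b ≤ i := hb ▸ c'.sizeUpTo_index_le i
  have h3 := (index_lt_iff c j b).2 h1
  have h4 := mt (index_lt_iff c i b).1 (not_lt_of_ge h2)
  omega

theorem isBoundary_of_parabolic_le {c c' : Composition n} (h : parabolic c F ≤ parabolic c' F)
    {a : ℕ} (ha : IsBoundary c' a) : IsBoundary c a := by
  by_contra hno
  have h0 : a ≠ 0 := fun h => hno (h ▸ isBoundary_zero c)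
  have hn : a < n := lt_of_le_of_ne ha.le fun h => hno (h ▸ isBoundary_last c)
  -- The elementary matrix at the place `(a, a - 1)` lies in the first group only.
  let i : Fin n := ⟨a - 1, by omega⟩
  let k : Fin n := ⟨a, hn⟩
  have hik : i ≠ k := fun h => by
    have := congrArg Fin.val h
    simp only [i, k] at this
    omega
  have hval : (k : ℕ) = i + 1 := by simp only [i, k]; omega
  have hu : unipotent (Pi.single k (1 : F)) (Pi.single i 1) (by simp [hik.symm])
      ∈ parabolic c F := by
    intro p q hpq
    change (1 + Matrix.vecMulVec _ _ : Matrix (Fin n) (Fin n) F) p q = 0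
    have hne : p ≠ q := fun h => by rw [h] at hpq; exact lt_irrefl _ hpq
    rw [Matrix.add_apply, Matrix.one_apply_ne hne, zero_add, Matrix.vecMulVec_apply]
    by_cases hp : p = k
    · by_cases hq : q = i
      · rw [hp, hq] at hpq
        exact absurd (isBoundary_of_index_lt c hval hpq) hno
      · simp [hq]
    · simp [hp]
  obtain ⟨b, -, hb⟩ := ha
  have hlt : c'.index i < c'.index k := by
    have h1 := (index_lt_iff c' i b).2 (by rw [hb]; simp only [i]; omega)
    have h2 := mt (index_lt_iff c' k b).1 (by rw [hb]; simp [k])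
    rw [Fin.lt_def]
    omega
  have h1 := h hu hlt
  change (1 + Matrix.vecMulVec _ _ : Matrix (Fin n) (Fin n) F) k i = 0 at h1
  rw [Matrix.add_apply, Matrix.one_apply_ne hik.symm, zero_add, Matrix.vecMulVec_apply] at h1
  simp at h1

theorem vecMul_inv_eq_zero {δ : Matrix.GeneralLinearGroup (Fin n) F} {a : ℕ} {v : Fin n → F}
    (hv : v ∈ tailSpan δ a) {j : Fin n} (hj : (j : ℕ) < a) :
    Matrix.vecMul v ((δ⁻¹ : Matrix.GeneralLinearGroup (Fin n) F) : Matrix (Fin n) (Fin n) F) j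
      = 0 := by
  induction hv using Submodule.span_induction with
  | mem v hv =>
    obtain ⟨i, rfl⟩ := hv
    have h : Matrix.vecMul ((δ : Matrix (Fin n) (Fin n) F) i)
        ((δ⁻¹ : Matrix.GeneralLinearGroup (Fin n) F) : Matrix (Fin n) (Fin n) F) =
        (1 : Matrix (Fin n) (Fin n) F) i := by
      rw [← Units.val_one, ← mul_inv_cancel δ, Units.val_mul, Matrix.mul_apply_eq_vecMul]
    rw [h]
    refine Matrix.one_apply_ne fun he => ?_
    have := i.2
    rw [he] at this
    omega
  | zero => simp
  | add x y _ _ hx hy => rw [Matrix.add_vecMul, Pi.add_apply, hx, hy, add_zero]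
  | smul t x _ hx => rw [Matrix.smul_vecMul, Pi.smul_apply, hx, smul_zero]

theorem coset_eq_of_tailSpan_eq {c : Composition n} {δ δ' : Matrix.GeneralLinearGroup (Fin n) F}
    (h : ∀ a, IsBoundary c a → tailSpan δ' a = tailSpan δ a) :
    (Quotient.mk _ δ : Cosets F c) = Quotient.mk _ δ' := by
  refine Quotient.sound (QuotientGroup.rightRel_apply.2 fun i j hij => ?_)
  rw [Units.val_mul, Matrix.mul_apply_eq_vecMul]
  have hb : IsBoundary c (c.sizeUpTo (c.index i)) := ⟨_, (c.index i).2.le, rfl⟩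
  refine vecMul_inv_eq_zero (a := c.sizeUpTo (c.index i)) ?_ ((index_lt_iff c j _).1 hij)
  rw [← h _ hb]
  exact Submodule.subset_span ⟨⟨i, c.sizeUpTo_index_le i⟩, rfl⟩

end Parabolics

/-! ### The canonical pair -/

section Canonical

variable {F : Type*} [Field F] [NumberField F] {n : ℕ}
  (g : Matrix.GeneralLinearGroup (Fin n) (AdeleRing (𝓞 F) F))

/-- The ordinate at `j` of the polygon of `(c, δ)`: at a boundary `j` of `c` it is the logarithmic
height of the span of the rows of `δ` of index at least `j`, and it is affine between boundaries. -/
def polygon (c : Composition n) (δ : Matrix.GeneralLinearGroup (Fin n) F) (j : ℕ) : ℝ :=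
  tailSum (inclA0 c (harishChandra c (diag δ * g))) j

variable (c : Composition n) (δ : Matrix.GeneralLinearGroup (Fin n) F)

theorem inclA0_congr (H : Fin c.length → ℝ) (i j : Fin n) (h : c.index i = c.index j) :
    inclA0 c H i = inclA0 c H j := by
  unfold inclA0
  rw [h]

theorem card_index_fiber (b : Fin c.length) :
    (Finset.univ.filter fun i => c.index i = b).card = c.blocksFun b := by
  have : (Finset.univ.filter fun i => c.index i = b) = Finset.univ.map (c.embedding b).toEmbedding
      := by
    ext i
    have := c.mem_range_embedding_iff' (j := i) (i := b)
    simp only [Finset.mem_filter, Finset.mem_univ, true_and, Finset.mem_map]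
    rw [eq_comm, ← this]
    rfl
  rw [this, Finset.card_map, Finset.card_univ, Fintype.card_fin]

theorem polygon_of_isBoundary {a : ℕ} (ha : IsBoundary c a) :
    polygon g c δ a = logHeight g (tailSpan δ a) := by
  obtain ⟨q, hq, hL⟩ := exists_exponents_tailSpan g δ
  obtain ⟨b, -, rfl⟩ := ha
  have key : ∀ f : Fin n → ℝ, ∑ i : Fin n with c.sizeUpTo b ≤ i.val, f i =
      ∑ β : Fin c.length, if b ≤ β then ∑ i with c.index i = β, f i else 0 := by
    intro f
    rw [Finset.sum_filter, ← Finset.sum_fiberwise _ c.index]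
    refine Finset.sum_congr rfl fun β _ => ?_
    have hiff : ∀ i : Fin n, c.index i = β → (c.sizeUpTo b ≤ i ↔ b ≤ (β : ℕ)) := by
      rintro i rfl
      rw [← not_lt, ← not_lt, index_lt_iff]
    split_ifs with h
    · exact Finset.sum_congr rfl fun i hi => if_pos ((hiff i (Finset.mem_filter.1 hi).2).2 h)
    · exact Finset.sum_eq_zero fun i hi => if_neg (mt (hiff i (Finset.mem_filter.1 hi).2).1 h)
  rw [hL, polygon, tailSum, key, key]
  refine Finset.sum_congr rfl fun β _ => ?_
  congr 1
  rw [← hq c β]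
  have hpos : (c.blocksFun β : ℝ) ≠ 0 := by
    exact Nat.cast_ne_zero.2 (Nat.one_le_iff_ne_zero.1 (c.one_le_blocksFun β))
  have : ∀ i ∈ Finset.univ.filter (fun i => c.index i = β),
      inclA0 c (harishChandra c (diag δ * g)) i
        = harishChandra c (diag δ * g) β / c.blocksFun β := by
    intro i hi
    rw [inclA0, (Finset.mem_filter.1 hi).2]
  rw [Finset.sum_congr rfl this, Finset.sum_const, card_index_fiber, nsmul_eq_mul,
    mul_div_cancel₀ _ hpos]

theorem rhoPairing_mk :
    rhoPairing g ⟨c, Quotient.mk _ δ⟩ = (n - 1) / 2 * logHeight g ⊤ -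
      ∑ j ∈ Finset.range n, polygon g c δ (j + 1) := by
  change ∑ i, rho c i * inclA0 c (harishChandra c (diag δ * g)) i = _
  rw [sum_rho_mul c (inclA0_congr c _)]
  have := polygon_of_isBoundary g c δ (isBoundary_zero c)
  rw [tailSpan_zero, polygon] at this
  rw [this]
  rfl

variable {g c δ}

theorem tilt_tailSpan {a : ℕ} (ha : IsBoundary c a) (t : ℝ) :
    tilt (logHeight g) t (tailSpan δ a) = polygon g c δ a - t * (n - a) := by
  rw [tilt, finrank_tailSpan, Nat.cast_sub ha.le, polygon_of_isBoundary g c δ ha]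

theorem polygon_interpolate {j : ℕ} (hj : j ≤ n) (hb : ¬ IsBoundary c j) :
    ∃ a a', IsBoundary c a ∧ IsBoundary c a' ∧ a < j ∧ j < a' ∧
      (∀ l, IsBoundary c l → a < l → l < a' → False) ∧
      ∀ t : ℝ, ((a' : ℝ) - a) * (polygon g c δ j - t * (n - j)) =
        (a' - j) * tilt (logHeight g) t (tailSpan δ a) +
          (j - a) * tilt (logHeight g) t (tailSpan δ a') := by
  obtain ⟨a, a', ha, ha', h1, h2, h3, h4⟩ := tailSum_interpolate c
    (inclA0_congr c (harishChandra c (diag δ * g))) hj hb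
  refine ⟨a, a', ha, ha', h1, h2, h3, fun t => ?_⟩
  rw [tilt_tailSpan ha, tilt_tailSpan ha']
  unfold polygon
  linear_combination h4

/-- Every polygon lies above all supporting lines of the Harder–Narasimhan polygon. -/
theorem le_polygon {t : ℝ} {W : Submodule F (Fin n → F)} (hW : IsMinimizer (logHeight g) t W)
    {j : ℕ} (hj : j ≤ n) : tilt (logHeight g) t W ≤ polygon g c δ j - t * (n - j) := by
  by_cases hb : IsBoundary c j
  · rw [← tilt_tailSpan hb]
    exact hW _
  · obtain ⟨a, a', -, -, h1, h2, -, h3⟩ := polygon_interpolate (g := g) (δ := δ) hj hb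
    have e1 : (0 : ℝ) < j - a := sub_pos.2 (Nat.cast_lt.2 h1)
    have e2 : (0 : ℝ) < a' - j := sub_pos.2 (Nat.cast_lt.2 h2)
    have e3 : (0 : ℝ) < (a' : ℝ) - a := by linarith
    refine le_of_mul_le_mul_left ?_ e3
    rw [h3 t]
    nlinarith [hW (tailSpan δ a), hW (tailSpan δ a')]

/-- Where the polygon of `(c, δ)` meets the Harder–Narasimhan polygon in a vertex, the flag of
`(c, δ)` contains the corresponding member of the Harder–Narasimhan filtration. -/
theorem tailSpan_eq_of_polygon_eq {t : ℝ} {U : Submodule F (Fin n → F)}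
    (hU : IsGreatestMinimizer (logHeight g) t U)
    (h : polygon g c δ (n - finrank F U) = logHeight g U) :
    IsBoundary c (n - finrank F U) ∧ tailSpan δ (n - finrank F U) = U := by
  have hUn : finrank F U ≤ n := by simpa using U.finrank_le
  set j := n - finrank F U with hj
  have hjn : j ≤ n := Nat.sub_le _ _
  have hUj : finrank F U = n - j := by omega
  have htilt : polygon g c δ j - t * (n - j) = tilt (logHeight g) t U := by
    rw [h, tilt, hUj, Nat.cast_sub hjn]
  have hbd : IsBoundary c j := by
    by_contra hb
    obtain ⟨a, a', -, -, h1, h2, -, h3⟩ := polygon_interpolate (g := g) (δ := δ) hjn hb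
    have e1 : (0 : ℝ) < j - a := sub_pos.2 (Nat.cast_lt.2 h1)
    have e2 : (0 : ℝ) < a' - j := sub_pos.2 (Nat.cast_lt.2 h2)
    have h4 := h3 t
    rw [htilt] at h4
    have h5 : tilt (logHeight g) t (tailSpan δ a) ≤ tilt (logHeight g) t U := by
      by_contra! hlt
      have := mul_lt_mul_of_pos_left hlt e2
      have := mul_le_mul_of_nonneg_left (hU.1 (tailSpan δ a')) e1.le
      linarith
    have h6 := Submodule.finrank_mono (hU.2 _ fun X => h5.trans (hU.1 X))
    rw [finrank_tailSpan] at h6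
    omega
  refine ⟨hbd, ?_⟩
  have h7 : tailSpan δ j ≤ U := hU.2 _ fun X => by
    rw [tilt_tailSpan hbd, htilt]
    exact hU.1 X
  exact Submodule.eq_of_le_of_finrank_eq h7 (by rw [finrank_tailSpan, hUj])

variable (g)

/-- The pair of the Harder–Narasimhan filtration. -/
theorem exists_harderNarasimhan_pair :
    ∃ (c₀ : Composition n) (δ₀ : Matrix.GeneralLinearGroup (Fin n) F),
      (∀ (c : Composition n) (δ : Matrix.GeneralLinearGroup (Fin n) F), ∀ j ≤ n,
        polygon g c₀ δ₀ j ≤ polygon g c δ j) ∧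
      ∀ (c : Composition n) (δ : Matrix.GeneralLinearGroup (Fin n) F),
        (∀ j ≤ n, polygon g c δ j = polygon g c₀ δ₀ j) →
        ∀ a, IsBoundary c₀ a → IsBoundary c a ∧ tailSpan δ a = tailSpan δ₀ a := by
  obtain ⟨S, hfin, hch, hbot, htop, hgr, hcons⟩ :=
    exists_harderNarasimhan (logHeight_submodular g) (logHeight_bot g)
  obtain ⟨δ₀, hδ₀⟩ := exists_GL_tailSpan hfin hch htop
  obtain ⟨c₀, hc₀⟩ := exists_composition (n := n)
    ((fun U : Submodule F (Fin n → F) => n - finrank F U) '' S)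
    ⟨⊤, htop, by simp⟩ ⟨⊥, hbot, by simp⟩ (by rintro _ ⟨U, -, rfl⟩; exact Nat.sub_le _ _)
  have hmem : ∀ a, IsBoundary c₀ a → tailSpan δ₀ a ∈ S ∧
      a = n - finrank F (tailSpan δ₀ a) := by
    intro a ha
    obtain ⟨U, hU, rfl⟩ := (hc₀ a).1 ha
    dsimp only
    rw [hδ₀ U hU]
    exact ⟨hU, rfl⟩
  have htight : ∀ j ≤ n, ∃ t W, IsMinimizer (logHeight g) t W ∧
      polygon g c₀ δ₀ j - t * (n - j) = tilt (logHeight g) t W := by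
    intro j hj
    by_cases hb : IsBoundary c₀ j
    · obtain ⟨t, ht⟩ := hgr _ (hmem j hb).1
      exact ⟨t, _, ht.1, (tilt_tailSpan hb t).symm⟩
    · obtain ⟨a, a', ha, ha', h1, h2, h3, h4⟩ := polygon_interpolate (g := g) (δ := δ₀) hj hb
      have ha'n := ha'.le
      have hlt : tailSpan δ₀ a' < tailSpan δ₀ a := by
        have hd : finrank F (tailSpan δ₀ a') < finrank F (tailSpan δ₀ a) := by
          rw [finrank_tailSpan, finrank_tailSpan]
          omega
        rcases hch.total (hmem a' ha').1 (hmem a ha).1 with h | h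
        · exact lt_of_le_of_ne h fun he => by rw [he] at hd; exact lt_irrefl _ hd
        · exact absurd (Submodule.finrank_mono h) (not_le_of_gt hd)
      obtain ⟨t, ht', ht⟩ := hcons _ (hmem a' ha').1 _ (hmem a ha).1 hlt (by
        intro X hX hX1 hX2
        have d1 := Submodule.finrank_lt_finrank_of_lt hX1
        have d2 := Submodule.finrank_lt_finrank_of_lt hX2
        rw [finrank_tailSpan] at d1 d2
        exact h3 (n - finrank F X) ((hc₀ _).2 ⟨X, hX, rfl⟩) (by omega) (by omega))
      refine ⟨t, _, ht, ?_⟩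
      have h5 := h4 t
      rw [le_antisymm (ht' (tailSpan δ₀ a)) (ht (tailSpan δ₀ a'))] at h5
      have e3 : (0 : ℝ) < (a' : ℝ) - a := sub_pos.2 (Nat.cast_lt.2 (h1.trans h2))
      refine mul_left_cancel₀ e3.ne' ?_
      linear_combination h5
  refine ⟨c₀, δ₀, fun c δ j hj => ?_, fun c δ h a ha => ?_⟩
  · obtain ⟨t, W, hW, hWj⟩ := htight j hj
    have := le_polygon (c := c) (δ := δ) hW hj
    linarith
  · obtain ⟨h1, h2⟩ := hmem a ha
    obtain ⟨t, ht⟩ := hgr _ h1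
    have h3 := tailSpan_eq_of_polygon_eq (c := c) (δ := δ) ht (by
      rw [← h2, h a ha.le, polygon_of_isBoundary g c₀ δ₀ ha])
    rwa [← h2] at h3

theorem isGreatest_degI_and_existsUnique_isCanonicalPair :
    IsGreatest (Set.range (rhoPairing g)) (degI g) ∧
      ∃! x : Pair F n, IsCanonicalPair g x := by
  obtain ⟨c₀, δ₀, hle, hflag⟩ := exists_harderNarasimhan_pair g
  set x₀ : Pair F n := ⟨c₀, Quotient.mk _ δ₀⟩ with hx₀
  have hle' : ∀ x : Pair F n, rhoPairing g x ≤ rhoPairing g x₀ := by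
    rintro ⟨c, x⟩
    induction x using Quotient.inductionOn with
    | h δ =>
      rw [hx₀, rhoPairing_mk, rhoPairing_mk]
      exact sub_le_sub_left (Finset.sum_le_sum fun j hj =>
        hle c δ (j + 1) (Finset.mem_range.1 hj)) _
  have hgreat : IsGreatest (Set.range (rhoPairing g)) (rhoPairing g x₀) :=
    ⟨⟨x₀, rfl⟩, by rintro _ ⟨x, rfl⟩; exact hle' x⟩
  have hdeg : degI g = rhoPairing g x₀ := hgreat.csSup_eq
  have hmax : ∀ c δ, rhoPairing g ⟨c, Quotient.mk _ δ⟩ = degI g →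
      ∀ a, IsBoundary c₀ a → IsBoundary c a ∧ tailSpan δ a = tailSpan δ₀ a := by
    intro c δ h
    refine hflag c δ fun j hj => ?_
    rw [hdeg, hx₀, rhoPairing_mk, rhoPairing_mk, sub_right_inj] at h
    have h' := (Finset.sum_eq_sum_iff_of_le fun j hj =>
        hle c δ (j + 1) (Finset.mem_range.1 hj)).1 h.symm
    cases j with
    | zero =>
      rw [polygon_of_isBoundary g c δ (isBoundary_zero c),
        polygon_of_isBoundary g c₀ δ₀ (isBoundary_zero c₀), tailSpan_zero, tailSpan_zero]
    | succ j => exact (h' j (Finset.mem_range.2 hj)).symm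
  refine ⟨hdeg ▸ hgreat, x₀, ⟨hdeg.symm, fun c h hc => ?_⟩, ?_⟩
  · have h1 := hmax c δ₀ hc
    exact composition_eq_of_isBoundary fun a =>
      ⟨fun ha => isBoundary_of_parabolic_le h ha, fun ha => (h1 a ha).1⟩
  · rintro ⟨c, x⟩ hx
    induction x using Quotient.inductionOn with
    | h δ =>
      have h1 := hmax c δ hx.1
      have hpar : parabolic c F ≤ parabolic c₀ F :=
        parabolic_le_of_isBoundary fun a ha => (h1 a ha).1
      have hcoset : (Quotient.mk _ δ : Cosets F c₀) = Quotient.mk _ δ₀ :=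
        coset_eq_of_tailSpan_eq fun a ha => (h1 a ha).2.symm
      have hproj : (⟨c₀, Cosets.proj hpar (Quotient.mk _ δ)⟩ : Pair F n) = x₀ := by
        rw [hx₀, ← hcoset]
        rfl
      obtain rfl : c₀ = c := hx.2 c₀ hpar (by rw [hproj, hdeg])
      rw [hx₀, hcoset]

end Canonical

end AdelicGL

end

theorem proposition2p4p1 (F : Type*) [Field F] [NumberField F] (n : ℕ) (hn : 1 ≤ n)
    (g : Matrix.GeneralLinearGroup (Fin n) (NumberField.AdeleRing (𝓞 F) F)) :
    IsGreatest (Set.range (AdelicGL.rhoPairing g)) (AdelicGL.degI g) ∧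
      ∃! x : AdelicGL.Pair F n, AdelicGL.IsCanonicalPair g x :=
  AdelicGL.isGreatest_degI_and_existsUnique_isCanonicalPair g
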